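/- Let $V$ be a finite non-empty set of integer-valued state variables. A \emph{trace} is a finite sequence $\tau=\alpha_0,\dots,\alpha_{m-1}$, $m\ge 1$, of assignments $\alpha_i:V\to\mathbb Z$. A \emph{gap-order constraint} (GC) has the form $x-y\ge k$ with $k\in\mathbb N$, where each of $x,y$ is either an integer or a state variable $v\in V$ decorated with some number $j\ge 0$ of primes, which refers to the value of $v$ looking $j$ instants ahead. Properties are given by $\psi ::= c \mid \psi\wedge\psi \mid \neg\psi \mid \mathsf X_s\psi \mid \psi\,\mathsf U\,\psi$ with $c$ a GC, and are evaluated on finite traces: a constraint holds at instant $i<m$ of $\tau$ if the values it refers to satisfy it or if it refers to an instant $\ge m$; no constraint holds at an instant $\ge m$; negation and conjunction are as usual; $\mathsf X_s\psi$ holds at $i$ if $i+1<m$ and $\psi$ holds at $i+1$; $\psi_1\mathsf U\psi_2$ holds at $i$ if $\psi_2$ holds at some $j$ with $i\le j<m$ and $\psi_1$ holds at all $k$ with $i\le k<j$. We write $\tau\models\psi$ if $\psi$ holds at instant $0$. A property is \emph{satisfiable} (\emph{valid}) if it is satisfied by some (by every) trace. A \emph{GC property} is one in which every constraint occurs under an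 even number of negations (so in negation normal form no GC is negated); a \emph{property over negated GCs} is one in which every constraint occurs under an odd number of negations. The \emph{monitoring state} of $\psi$ after a trace $\tau$ is $\mathrm{CS}$ if $\tau\models\psi$ and $\tau\tau'\not\models\psi$ for some trace $\tau'$; $\mathrm{PS}$ if $\tau\models\psi$ and $\tau\tau'\models\psi$ for every trace $\tau'$; $\mathrm{CV}$ if $\tau\not\models\psi$ and $\tau\tau'\models\psi$ for some trace $\tau'$; $\mathrm{PV}$ if $\tau\not\models\psi$ and $\tau\tau'\not\models\psi$ for every trace $\tau'$. For every finite non-empty $V$ the following hold. 1. Monitoring of GC properties is not solvable: no algorithm computes, from a GC property $\psi$ and a trace $\tau$, the monitoring state of $\psi$ after $\tau$. Indeed, there is even a single GC property $\psi$ for which no algorithm computes, from a trace $\tau$, the monitoring state of $\psi$ after $\tau$. 2. Validity of GC properties is undecidable. 3. Properties over negated GCs can simulate 2-counter machines: there is a computable map that sends each pair $(M,q)$ of a (nondeterministic) 2-counter machine $M$, whose transitions increment a counter, decrement a positive counter, or test a counter for zero, and a control state $q$ to a property $\psi_{M,q}$ over negated GCs such that $q$ is reachable in $M$ from its initial state with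 both counters zero if and only if $\psi_{M,q}$ is satisfiable. -/

import Mathlib

namespace GapOrder

/-! Properties over gap-order constraints, evaluated on finite traces.
The state variables are the elements of `Fin n`, all of integer sort. -/

/-- A term of a gap-order constraint: `Sum.inl (v, j)` is the state variable `v` decorated with
`j` primes (the value of `v` looking `j` instants ahead), `Sum.inr c` is an integer constant. -/
abbrev GCTerm (n : ℕ) : Type := (Fin n × ℕ) ⊕ ℤ

/-- The triple `(x, y, k)` is the gap-order constraint `x - y ≥ k`, where `k` is a natural
number. -/
abbrev GapConstraint (n : ℕ) : Type := GCTerm n × GCTerm n × ℕ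

/-- Linear-time properties whose atoms are gap-order constraints. -/
inductive Property (n : ℕ) : Type
  | atom (c : GapConstraint n) : Property n
  | and (φ ψ : Property n) : Property n
  | not (φ : Property n) : Property n
  | next (φ : Property n) : Property n
  | untl (φ ψ : Property n) : Property n

/-- An assignment of integers to the state variables. -/
abbrev Assignment (n : ℕ) : Type := Fin n → ℤ

/-- A trace is a finite sequence of assignments. Traces have length at least one: the
hypothesis `τ ≠ []` is written wherever traces are quantified over. -/
abbrev Trace (n : ℕ) : Type := List (Assignment n)

/-- The number of primes of a term. -/
def GCTerm.lookahead {n : ℕ} : GCTerm n → ℕ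
  | Sum.inl (_, j) => j
  | Sum.inr _ => 0

/-- The value of a term at instant `i` (meaningful only if the term does not look beyond the
end of the trace). -/
def GCTerm.value {n : ℕ} (τ : Trace n) (i : ℕ) : GCTerm n → ℤ
  | Sum.inl (v, j) => τ.getD (i + j) 0 v
  | Sum.inr c => c

/-- A constraint is well-defined at instant `i` if it does not look beyond the end of the
trace. -/
def GapConstraint.WellDefined {n : ℕ} (τ : Trace n) (i : ℕ) (c : GapConstraint n) : Prop :=
  i + GCTerm.lookahead c.1 < τ.length ∧ i + GCTerm.lookahead c.2.1 < τ.length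

/-- `HoldsAt τ i ψ`: the property `ψ` holds at instant `i` of `τ`. Constraints that look beyond
the end of the trace hold (weak semantics of lookahead); the next operator is the strong one. -/
def HoldsAt {n : ℕ} (τ : Trace n) : ℕ → Property n → Prop
  | i, .atom c => i < τ.length ∧
      (¬ GapConstraint.WellDefined τ i c ∨
        GCTerm.value τ i c.1 - GCTerm.value τ i c.2.1 ≥ (c.2.2 : ℤ))
  | i, .and φ ψ => HoldsAt τ i φ ∧ HoldsAt τ i ψ
  | i, .not φ => ¬ HoldsAt τ i φ
  | i, .next φ => i + 1 < τ.length ∧ HoldsAt τ (i + 1) φ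
  | i, .untl φ ψ => ∃ j, i ≤ j ∧ j < τ.length ∧ HoldsAt τ j ψ ∧
      ∀ k, i ≤ k → k < j → HoldsAt τ k φ

/-- The usual unfolding of the until operator on finite traces. -/
theorem holdsAt_until_iff {n : ℕ} (τ : Trace n) (i : ℕ) (φ ψ : Property n) :
    HoldsAt τ i (.untl φ ψ) ↔ i < τ.length ∧
      (HoldsAt τ i ψ ∨
        (i + 1 < τ.length ∧ HoldsAt τ i φ ∧ HoldsAt τ (i + 1) (.untl φ ψ))) := by
  simp only [HoldsAt]
  constructor
  · rintro ⟨j, hij, hj, hψ, hφ⟩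
    refine ⟨by omega, ?_⟩
    rcases Nat.eq_or_lt_of_le hij with rfl | h
    · exact Or.inl hψ
    · exact Or.inr ⟨by omega, hφ i le_rfl h, j, h, hj, hψ, fun k h1 h2 => hφ k (by omega) h2⟩
  · rintro ⟨hi, hψ | ⟨-, hφ, j, hij, hj, hψ, hall⟩⟩
    · exact ⟨i, le_rfl, hi, hψ, fun k h1 h2 => absurd h1 (by omega)⟩
    · refine ⟨j, by omega, hj, hψ, fun k h1 h2 => ?_⟩
      rcases Nat.eq_or_lt_of_le h1 with rfl | h
      · exact hφ
      · exact hall k h h2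

/-- The trace `τ` satisfies `ψ`. -/
def Satisfies {n : ℕ} (τ : Trace n) (ψ : Property n) : Prop := HoldsAt τ 0 ψ

/-- `ψ` holds on some (non-empty) trace. -/
def Satisfiable {n : ℕ} (ψ : Property n) : Prop := ∃ τ : Trace n, τ ≠ [] ∧ Satisfies τ ψ

/-- `ψ` holds on all (non-empty) traces. -/
def Valid {n : ℕ} (ψ : Property n) : Prop := ∀ τ : Trace n, τ ≠ [] → Satisfies τ ψ

/-- All occurrences of constraints in the property are under an even number of negations
(`b = true`), respectively under an odd number of negations (`b = false`). -/
def HasPolarity {n : ℕ} : Bool → Property n → Prop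
  | b, .atom _ => b = true
  | b, .and φ ψ => HasPolarity b φ ∧ HasPolarity b ψ
  | b, .not φ => HasPolarity (!b) φ
  | b, .next φ => HasPolarity b φ
  | b, .untl φ ψ => HasPolarity b φ ∧ HasPolarity b ψ

/-- Gap-order-constraint properties: in negation normal form, all literals are gap-order
constraints (none of them negated). -/
def IsGCProperty {n : ℕ} (ψ : Property n) : Prop := HasPolarity true ψ

/-- Properties over negated gap-order constraints: in negation normal form, all literals are
negated gap-order constraints. -/
def IsNegGCProperty {n : ℕ} (ψ : Property n) : Prop := HasPolarity false ψ

/-! ### Properties as inputs of procedures -/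

/-- Alphabet for writing properties: gap-order constraints, and one symbol for each of the four
connectives. -/
abbrev Letter (n : ℕ) : Type := GapConstraint n ⊕ Fin 4

/-- The word (in prefix notation) that represents a property when it is given to, or produced
by, a procedure. -/
def Property.word {n : ℕ} : Property n → List (Letter n)
  | .atom c => [Sum.inl c]
  | .and φ ψ => Sum.inr 0 :: (φ.word ++ ψ.word)
  | .not φ => Sum.inr 1 :: φ.word
  | .next φ => Sum.inr 2 :: φ.word
  | .untl φ ψ => Sum.inr 3 :: (φ.word ++ ψ.word)

theorem Property.word_append_inj {n : ℕ} (φ : Property n) : ∀ (ψ : Property n)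
    (r s : List (Letter n)), φ.word ++ r = ψ.word ++ s → φ = ψ ∧ r = s := by
  induction φ with
  | atom c => intro ψ r s h; cases ψ <;> simp_all [Property.word]
  | not φ ih =>
    intro ψ r s h
    cases ψ <;> simp [Property.word] at h
    obtain ⟨rfl, rfl⟩ := ih _ _ _ h
    exact ⟨rfl, rfl⟩
  | next φ ih =>
    intro ψ r s h
    cases ψ <;> simp [Property.word] at h
    obtain ⟨rfl, rfl⟩ := ih _ _ _ h
    exact ⟨rfl, rfl⟩
  | and φ₁ φ₂ ih₁ ih₂ =>
    intro ψ r s h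
    cases ψ <;> simp [Property.word] at h
    obtain ⟨rfl, e⟩ := ih₁ _ _ _ h
    obtain ⟨rfl, rfl⟩ := ih₂ _ _ _ e
    exact ⟨rfl, rfl⟩
  | untl φ₁ φ₂ ih₁ ih₂ =>
    intro ψ r s h
    cases ψ <;> simp [Property.word] at h
    obtain ⟨rfl, e⟩ := ih₁ _ _ _ h
    obtain ⟨rfl, rfl⟩ := ih₂ _ _ _ e
    exact ⟨rfl, rfl⟩

/-- Distinct properties are represented by distinct words. -/
theorem Property.word_injective {n : ℕ} :
    Function.Injective (Property.word : Property n → List (Letter n)) := fun φ ψ h =>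
  (Property.word_append_inj φ ψ [] [] (by simpa using h)).1

/-! ### Monitoring -/

/-- Monitoring states: current satisfaction, permanent satisfaction, current violation,
permanent violation. -/
inductive MonitoringState : Type
  | cs | ps | cv | pv

/-- Numbering of the four monitoring states. -/
def MonitoringState.equivFin : MonitoringState ≃ Fin 4 where
  toFun
    | .cs => 0
    | .ps => 1
    | .cv => 2
    | .pv => 3
  invFun
    | 0 => .cs
    | 1 => .ps
    | 2 => .cv
    | 3 => .pv
  left_inv := by intro s; cases s <;> rfl
  right_inv := by intro i; fin_cases i <;> rfl

instance : Primcodable MonitoringState := Primcodable.ofEquiv (Fin 4) MonitoringState.equivFin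

/-- `InState τ ψ s`: the property `ψ` is in monitoring state `s` after the trace `τ`. -/
def InState {n : ℕ} (τ : Trace n) (ψ : Property n) : MonitoringState → Prop
  | .cs => Satisfies τ ψ ∧ ∃ τ' : Trace n, τ' ≠ [] ∧ ¬ Satisfies (τ ++ τ') ψ
  | .ps => Satisfies τ ψ ∧ ∀ τ' : Trace n, τ' ≠ [] → Satisfies (τ ++ τ') ψ
  | .cv => ¬ Satisfies τ ψ ∧ ∃ τ' : Trace n, τ' ≠ [] ∧ Satisfies (τ ++ τ') ψ
  | .pv => ¬ Satisfies τ ψ ∧ ∀ τ' : Trace n, τ' ≠ [] → ¬ Satisfies (τ ++ τ') ψ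

/-- Monitoring is solvable for the single property `ψ`: some procedure computes the monitoring
state of `ψ` after any given trace. -/
def MonitoringSolvableFor {n : ℕ} (ψ : Property n) : Prop :=
  ∃ f : Trace n →. MonitoringState, Partrec f ∧
    ∀ τ : Trace n, τ ≠ [] → ∃ s ∈ f τ, InState τ ψ s

/-- Monitoring is solvable for the class `K` of properties, uniformly: some procedure computes
the monitoring state from a property of the class and a trace. The procedure may behave
arbitrarily on inputs that do not represent a property of the class. -/
def MonitoringSolvable {n : ℕ} (K : Property n → Prop) : Prop :=
  ∃ f : List (Letter n) × Trace n →. MonitoringState, Partrec f ∧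
    ∀ ψ : Property n, K ψ → ∀ τ : Trace n, τ ≠ [] → ∃ s ∈ f (ψ.word, τ), InState τ ψ s

/-- Validity is decidable for the class `K` of properties. The procedure may behave arbitrarily
on inputs that do not represent a property of the class. -/
def ValidityDecidable {n : ℕ} (K : Property n → Prop) : Prop :=
  ∃ f : List (Letter n) →. Bool, Partrec f ∧
    ∀ ψ : Property n, K ψ → ∃ b ∈ f ψ.word, (b = true ↔ Valid ψ)

/-! ### Two-counter machines -/

/-- The operations on a counter. -/
inductive CounterOp : Type
  | inc | dec | isZero

/-- Numbering of the three counter operations. -/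
def CounterOp.equivFin : CounterOp ≃ Fin 3 where
  toFun
    | .inc => 0
    | .dec => 1
    | .isZero => 2
  invFun
    | 0 => .inc
    | 1 => .dec
    | 2 => .isZero
  left_inv := by intro s; cases s <;> rfl
  right_inv := by intro i; fin_cases i <;> rfl

instance : Primcodable CounterOp := Primcodable.ofEquiv (Fin 3) CounterOp.equivFin

/-- `(p, c, o, q)` is the transition from control state `p` to control state `q` that performs
the operation `o` on the counter `c`. -/
abbrev CounterTransition : Type := ℕ × Fin 2 × CounterOp × ℕ

/-- A (nondeterministic) two-counter machine: its initial control state and its finite list of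
transitions. Control states are named by natural numbers. -/
abbrev CounterMachine : Type := ℕ × List CounterTransition

/-- A configuration: control state and counter values. -/
abbrev CounterConfig : Type := ℕ × (Fin 2 → ℕ)

/-- The effect of a counter operation on a counter value: a decrement is enabled only on a
positive counter, a zero test only on a counter that is zero. -/
def CounterOp.Effect : CounterOp → ℕ → ℕ → Prop
  | .inc, a, b => b = a + 1
  | .dec, a, b => 0 < a ∧ b = a - 1
  | .isZero, a, b => a = 0 ∧ b = a

/-- One step of a two-counter machine. -/
def CounterMachine.Step (M : CounterMachine) (s t : CounterConfig) : Prop :=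
  ∃ (c : Fin 2) (o : CounterOp), (s.1, c, o, t.1) ∈ M.2 ∧
    CounterOp.Effect o (s.2 c) (t.2 c) ∧ ∀ d : Fin 2, d ≠ c → t.2 d = s.2 d

/-- The control state `q` is reachable from the initial control state with both counters
zero. -/
def CounterMachine.Reaches (M : CounterMachine) (q : ℕ) : Prop :=
  ∃ t : CounterConfig, t.1 = q ∧
    Relation.ReflTransGen (CounterMachine.Step M) (M.1, fun _ => 0) t

end GapOrder

/-! A negated gap-order constraint is a strict bound `x - y < k`; since lookahead is weak, it also
forces both terms to lie inside the trace. Two of them express `x = y + c` for `c ≤ 1`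
(`holdsAt_eqc`), so properties over negated constraints can test, copy, increment and decrement
values across a fixed lookahead.

A configuration with `k` registers is written on `k + 1` successive instants of a single variable:
the control state as a negative integer, then the registers, which are nonnegative. The sign shows
where a configuration starts, and an until formula demands that every start before the goal state is
followed by a successor configuration. A trace that satisfies this formula yields a run
(`exists_run_of_holdsAt`), and every run can be written as such a trace (`exists_trace_of_run`).
Counter machines are the case `k = 2`.

The negation of such a formula is a GC property. It is valid, or permanently satisfied after the
block of a configuration (`InState.not_reachProp_iff`), exactly when there is no run. It remains to
find an undecidable reachability problem, with any number of registers. Every partial recursive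
function is computed by a nondeterministic regular program (`Prog.exists_computes`), a program
compiles to a finite list of rules (`Prog.exec_iff_ruleStep`), and the halting problem then gives
one fixed list whose reachability from a variable input is undecidable
(`exists_rules_not_computable`). -/

namespace GapOrder

/-! ### Regular programs on registers -/

/-- Elementary operations on a store of natural number registers. -/
inductive RegOp : Type
  | succ (r : ℕ)
  | dec (r : ℕ)
  | zero (r : ℕ)
  | copy (r x : ℕ)
  | isZero (r : ℕ)
  | eq (x y : ℕ)
  | lt (x y : ℕ)
  deriving Countable

/-- The condition under which an operation is enabled. -/
def RegOp.Guard (s : ℕ → ℕ) : RegOp → Prop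
  | .dec r => 0 < s r
  | .isZero r => s r = 0
  | .eq x y => s x = s y
  | .lt x y => s x < s y
  | _ => True

/-- The store after an operation. -/
def RegOp.apply (s : ℕ → ℕ) : RegOp → ℕ → ℕ
  | .succ r => Function.update s r (s r + 1)
  | .dec r => Function.update s r (s r - 1)
  | .zero r => Function.update s r 0
  | .copy r x => Function.update s r (s x)
  | _ => s

/-- Regular programs over the register operations. -/
inductive Prog : Type
  | op (o : RegOp)
  | seq (p q : Prog)
  | alt (p q : Prog)
  | star (p : Prog)
  deriving Countable

/-- Input-output relation of a regular program. -/
def Prog.Exec : Prog → (ℕ → ℕ) → (ℕ → ℕ) → Prop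
  | .op o, s, t => o.Guard s ∧ t = o.apply s
  | .seq p q, s, t => ∃ u, p.Exec s u ∧ q.Exec u t
  | .alt p q, s, t => p.Exec s t ∨ q.Exec s t
  | .star p, s, t => Relation.ReflTransGen p.Exec s t

/-! ### Pairing and unpairing by counting -/

/-- `Nat.pair` runs through the shells `max a b = m` in the order `(0, m), …, (m - 1, m), (m, 0), …,
(m, m)`. So pairs can be enumerated with increments, resets and comparisons only, without
multiplication. -/
theorem unpair_succ (N : ℕ) : (N + 1).unpair =
    if N.unpair.1 < N.unpair.2 then
      (if N.unpair.1 + 1 < N.unpair.2 then (N.unpair.1 + 1, N.unpair.2) else (N.unpair.2, 0))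
    else if N.unpair.2 < N.unpair.1 then (N.unpair.1, N.unpair.2 + 1)
      else (0, N.unpair.1 + 1) := by
  obtain ⟨a, b, rfl⟩ : ∃ a b, N = Nat.pair a b := ⟨_, _, (Nat.pair_unpair N).symm⟩
  rw [Nat.unpair_pair]
  simp only
  rw [← Nat.pair_unpair (Nat.pair a b + 1)]
  refine (Nat.pairEquiv.symm_apply_eq (x := Nat.pair _ _)).2 ?_ |>.trans rfl
  rw [Nat.pair_unpair]
  simp only [Nat.pairEquiv, Equiv.coe_fn_mk, Function.uncurry_def]
  split_ifs with h1 h2 h3 <;> simp only [Nat.pair] <;> split_ifs <;> first | omega | skip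
  obtain rfl : b = a := by omega
  ring

/-- The store `s` in which registers `r`, `r + 1`, `r + 2` hold `N` and the two components of
the pair that is coded by `N`. -/
def withPair (s : ℕ → ℕ) (r N : ℕ) : ℕ → ℕ := fun d =>
  if d = r then N else if d = r + 1 then N.unpair.1 else if d = r + 2 then N.unpair.2 else s d

/-- Advances the three registers from `r` on from a number and its two components to the next
number and its two components. -/
def Prog.nextPair (r : ℕ) : Prog :=
  .seq (.op (.succ r)) <| .alt
    (.seq (.op (.lt (r + 1) (r + 2))) <| .seq (.op (.succ (r + 1))) <| .alt
      (.op (.lt (r + 1) (r + 2)))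
      (.seq (.op (.eq (r + 1) (r + 2))) (.op (.zero (r + 2)))))
    (.alt
      (.seq (.op (.lt (r + 2) (r + 1))) (.op (.succ (r + 2))))
      (.seq (.op (.eq (r + 1) (r + 2))) (.seq (.op (.zero (r + 1))) (.op (.succ (r + 2))))))

theorem Prog.exec_nextPair (s t : ℕ → ℕ) (r N : ℕ) :
    (nextPair r).Exec (withPair s r N) t ↔ t = withPair s r (N + 1) := by
  simp only [nextPair, Exec, RegOp.Guard, RegOp.apply, true_and, exists_eq_left]
  have hu := unpair_succ N
  have w0 : ∀ d, withPair s r N d = if d = r then N else if d = r + 1 then N.unpair.1 else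
    if d = r + 2 then N.unpair.2 else s d := fun _ => rfl
  have w1 : ∀ d, withPair s r (N + 1) d = if d = r then N + 1 else if d = r + 1 then
    (N + 1).unpair.1 else if d = r + 2 then (N + 1).unpair.2 else s d := fun _ => rfl
  generalize N.unpair.1 = a at hu w0 ⊢
  generalize N.unpair.2 = b at hu w0 ⊢
  generalize withPair s r N = u at w0 ⊢
  have h0 : r + 1 ≠ r := by omega
  have h1 : r + 2 ≠ r := by omega
  have h2 : r + 2 ≠ r + 1 := by omega
  have h3 : r + 1 ≠ r + 2 := by omega
  have e1 : Function.update u r (u r + 1) (r + 1) = a := by simp [w0]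
  have e2 : Function.update u r (u r + 1) (r + 2) = b := by simp [w0]
  have e3 : ∀ x, Function.update (Function.update u r (u r + 1)) (r + 1) x (r + 1) = x := by simp
  have e4 : ∀ x, Function.update (Function.update u r (u r + 1)) (r + 1) x (r + 2) = b := by
    simp [w0]
  simp only [e1, e2, e3, e4, exists_and_left, exists_eq_left, and_assoc]
  rcases lt_trichotomy a b with h | rfl | h
  · rcases Nat.lt_or_eq_of_le (Nat.succ_le_of_lt h) with h' | rfl
    · simp only [h, h.ne, h.not_gt, show a + 1 < b from h', show a + 1 ≠ b from h'.ne, if_true, if_false,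
        true_and, false_and, or_false] at hu ⊢
      refine iff_of_eq (congrArg (t = ·) (funext fun d => ?_))
      simp only [w1, hu, Function.update_apply, w0, if_true]
      split_ifs <;> first | rfl | omega
    · simp only [h, h.ne, h.not_gt, Nat.succ_eq_add_one, lt_irrefl, if_true, if_false, true_and, false_and,
        or_false,
        false_or] at hu ⊢
      refine iff_of_eq (congrArg (t = ·) (funext fun d => ?_))
      simp only [w1, hu, Function.update_apply, w0, if_true]
      split_ifs <;> first | rfl | omega
  · simp only [lt_irrefl, if_false, true_and, false_and, false_or] at hu ⊢
    refine iff_of_eq (congrArg (t = ·) (funext fun d => ?_))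
    simp only [w1, hu, Function.update_apply, w0, if_true]
    split_ifs <;> first | rfl | omega
  · simp only [h, h.ne', h.not_gt, if_true, if_false, true_and, false_and, or_false,
      false_or] at hu ⊢
    refine iff_of_eq (congrArg (t = ·) (funext fun d => ?_))
    simp only [w1, hu, Function.update_apply, w0, if_true]
    split_ifs <;> first | rfl | omega

/-- Sets `r` to the code of the pair held by `x` and `y`. -/
def Prog.pairInto (r x y : ℕ) : Prog :=
  .seq (.op (.zero r)) <| .seq (.op (.zero (r + 1))) <| .seq (.op (.zero (r + 2))) <|
    .seq (.star (nextPair r)) <| .seq (.op (.eq (r + 1) x)) (.op (.eq (r + 2) y))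

/-- Sets `r + 1` and `r + 2` to the components of the pair coded by `x`. -/
def Prog.unpairInto (r x : ℕ) : Prog :=
  .seq (.op (.zero r)) <| .seq (.op (.zero (r + 1))) <| .seq (.op (.zero (r + 2))) <|
    .seq (.star (nextPair r)) (.op (.eq r x))

theorem Prog.exec_star_nextPair (s t : ℕ → ℕ) (r : ℕ) :
    (star (nextPair r)).Exec (withPair s r 0) t ↔ ∃ N, t = withPair s r N := by
  constructor
  · intro h
    simp only [Exec] at h
    induction h with
    | refl => exact ⟨0, rfl⟩
    | tail _ h ih =>
      obtain ⟨N, rfl⟩ := ih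
      exact ⟨N + 1, (exec_nextPair _ _ _ _).1 h⟩
  · rintro ⟨N, rfl⟩
    induction N with
    | zero => exact .refl
    | succ N ih => exact .tail ih ((exec_nextPair _ _ _ _).2 rfl)

theorem update_zero_eq_withPair (s : ℕ → ℕ) (r : ℕ) :
    Function.update (Function.update (Function.update s r 0) (r + 1) 0) (r + 2) 0 =
      withPair s r 0 := by
  funext d
  simp only [withPair, Function.update_apply, Nat.unpair_zero]
  split_ifs <;> rfl

/-- The star guesses how far to count, and the final equality tests reject every guess but one, so
the nondeterministic program is a function. The operands lie below `r`, where counting does not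
touch them. -/
theorem Prog.exec_pairInto {s t : ℕ → ℕ} {r x y : ℕ} (hx : x < r) (hy : y < r) :
    (pairInto r x y).Exec s t ↔ t = withPair s r (Nat.pair (s x) (s y)) := by
  have h := exec_star_nextPair s
  simp only [Exec] at h
  simp only [pairInto, Exec, RegOp.Guard, RegOp.apply, true_and, exists_eq_left,
    update_zero_eq_withPair, h]
  have e1 : x ≠ r := by omega
  have e2 : y ≠ r := by omega
  have e3 : x ≠ r + 1 := by omega
  have e4 : y ≠ r + 1 := by omega
  have e5 : x ≠ r + 2 := by omega
  have e6 : y ≠ r + 2 := by omega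
  constructor
  · rintro ⟨_, ⟨N, rfl⟩, _, ⟨h1, rfl⟩, h2, rfl⟩
    simp [withPair, e1, e2, e3, e4, e5, e6] at h1 h2
    rw [← h1, ← h2, Nat.pair_unpair]
  · rintro rfl
    refine ⟨_, ⟨_, rfl⟩, _, ⟨?_, rfl⟩, ?_, rfl⟩ <;> simp [withPair, e1, e2, e3, e4, e5, e6]

theorem Prog.exec_unpairInto {s t : ℕ → ℕ} {r x : ℕ} (hx : x < r) :
    (unpairInto r x).Exec s t ↔ t = withPair s r (s x) := by
  have h := exec_star_nextPair s
  simp only [Exec] at h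
  simp only [unpairInto, Exec, RegOp.Guard, RegOp.apply, true_and, exists_eq_left,
    update_zero_eq_withPair, h]
  have e1 : x ≠ r := by omega
  have e3 : x ≠ r + 1 := by omega
  have e5 : x ≠ r + 2 := by omega
  constructor
  · rintro ⟨_, ⟨N, rfl⟩, h1, rfl⟩
    simp [withPair, e1, e3, e5] at h1
    rw [← h1]
  · rintro rfl
    refine ⟨_, ⟨_, rfl⟩, ?_, rfl⟩
    simp [withPair, e1, e3, e5]

theorem withPair_self (s : ℕ → ℕ) (r N : ℕ) : withPair s r N r = N := by simp [withPair]

theorem withPair_fst (s : ℕ → ℕ) (r N : ℕ) : withPair s r N (r + 1) = N.unpair.1 := by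
  simp [withPair]

theorem withPair_snd (s : ℕ → ℕ) (r N : ℕ) : withPair s r N (r + 2) = N.unpair.2 := by
  simp [withPair]

theorem withPair_of_lt (s : ℕ → ℕ) {r d : ℕ} (N : ℕ) (h : d < r) : withPair s r N d = s d := by
  simp [withPair, h.ne, show d ≠ r + 1 by omega, show d ≠ r + 2 by omega]

/-! ### Programs for the partial recursive functions -/

/-- The program computes the partial function `f` in register `m` and leaves the registers below
`m` unchanged. -/
def Prog.Computes (P : Prog) (m : ℕ) (f : ℕ →. ℕ) : Prop :=
  (∀ s t, P.Exec s t → t m ∈ f (s m) ∧ ∀ r < m, t r = s r) ∧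
    ∀ s, ∀ b ∈ f (s m), ∃ t, P.Exec s t ∧ t m = b

theorem Prog.Computes.of_fun {P : Prog} {m : ℕ} {f : ℕ → ℕ} (g : (ℕ → ℕ) → ℕ → ℕ)
    (hP : ∀ s t, P.Exec s t ↔ t = g s) (hm : ∀ s, g s m = f (s m))
    (hr : ∀ s, ∀ r < m, g s r = s r) : P.Computes m f := by
  refine ⟨fun s t h => ?_, fun s b hb => ⟨g s, (hP _ _).2 rfl, ?_⟩⟩
  · rw [(hP _ _).1 h]
    exact ⟨by simp [hm], hr s⟩
  · rw [hm]
    exact (Part.mem_some_iff.1 hb).symm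

theorem Prog.exists_computes_left (m : ℕ) :
    ∃ P : Prog, P.Computes m (fun n : ℕ => (n.unpair.1 : Part ℕ)) := by
  refine ⟨.seq (unpairInto (m + 1) m) (.op (.copy m (m + 2))), .of_fun
    (fun s => Function.update (withPair s (m + 1) (s m)) m (s m).unpair.1) ?_ ?_ ?_⟩
  · intro s t
    simp [Exec, exec_unpairInto, RegOp.Guard, RegOp.apply, withPair_fst s (m + 1)]
  · simp
  · intro s r hr
    rw [Function.update_of_ne hr.ne, withPair_of_lt _ _ (by omega)]

theorem Prog.exists_computes_right (m : ℕ) :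
    ∃ P : Prog, P.Computes m (fun n : ℕ => (n.unpair.2 : Part ℕ)) := by
  refine ⟨.seq (unpairInto (m + 1) m) (.op (.copy m (m + 3))), .of_fun
    (fun s => Function.update (withPair s (m + 1) (s m)) m (s m).unpair.2) ?_ ?_ ?_⟩
  · intro s t
    simp [Exec, exec_unpairInto, RegOp.Guard, RegOp.apply, withPair_snd s (m + 1)]
  · simp
  · intro s r hr
    rw [Function.update_of_ne hr.ne, withPair_of_lt _ _ (by omega)]

/-- Runs `P` on a copy of register `x` in register `m`. -/
def Prog.call (P : Prog) (m x : ℕ) : Prog := .seq (.op (.copy m x)) P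

theorem Prog.Computes.call {P : Prog} {m : ℕ} {f : ℕ →. ℕ} (h : P.Computes m f) (x : ℕ) :
    (∀ s t, (P.call m x).Exec s t → t m ∈ f (s x) ∧ ∀ r < m, t r = s r) ∧
      ∀ s, ∀ b ∈ f (s x), ∃ t, (P.call m x).Exec s t ∧ t m = b := by
  simp only [Prog.call, Prog.Exec, RegOp.Guard, RegOp.apply, true_and, exists_eq_left]
  refine ⟨fun s t ht => ?_, fun s b hb => h.2 _ b (by simpa using hb)⟩
  obtain ⟨h1, h2⟩ := h.1 _ _ ht
  refine ⟨by simpa using h1, fun r hr => ?_⟩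
  rw [h2 r hr, Function.update_of_ne hr.ne]

/-- Working registers are stacked: `Q` runs from `m + 2` on, so it preserves both the argument in
`m` and the result of `P` in `m + 1`. -/
theorem Prog.exists_computes_pair {f g : ℕ →. ℕ} {m : ℕ} {P Q : Prog}
    (hP : P.Computes (m + 1) f) (hQ : Q.Computes (m + 2) g) :
    ∃ R : Prog, R.Computes m (fun n => Nat.pair <$> f n <*> g n) := by
  refine ⟨.seq (P.call (m + 1) m) <| .seq (Q.call (m + 2) m) <|
    .seq (pairInto (m + 3) (m + 1) (m + 2)) (.op (.copy m (m + 3))), ?_, ?_⟩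
  · rintro s t ⟨u, hu, v, hv, w, hw, -, rfl⟩
    rw [exec_pairInto (by omega) (by omega)] at hw
    subst hw
    obtain ⟨h1, h2⟩ := (hP.call m).1 _ _ hu
    obtain ⟨h3, h4⟩ := (hQ.call m).1 _ _ hv
    rw [h2 m (by omega)] at h3
    rw [← h4 (m + 1) (by omega)] at h1
    refine ⟨?_, fun r hr => ?_⟩
    · simp only [RegOp.apply, Function.update_self, withPair_self]
      simp only [Seq.seq, Part.map_eq_map, Part.mem_bind_iff, Part.mem_map_iff]
      exact ⟨_, ⟨_, h1, rfl⟩, _, h3, rfl⟩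
    · simp only [RegOp.apply]
      rw [Function.update_of_ne hr.ne, withPair_of_lt _ _ (by omega), h4 r (by omega),
        h2 r (by omega)]
  · intro s b hb
    simp only [Seq.seq, Part.map_eq_map, Part.mem_bind_iff, Part.mem_map_iff] at hb
    obtain ⟨_, ⟨x, hx, rfl⟩, y, hy, rfl⟩ := hb
    obtain ⟨u, hu, rfl⟩ := (hP.call m).2 _ _ hx
    rw [← ((hP.call m).1 _ _ hu).2 m (by omega)] at hy
    obtain ⟨v, hv, rfl⟩ := (hQ.call m).2 _ _ hy
    refine ⟨_, ⟨u, hu, v, hv, _, (exec_pairInto (by omega) (by omega)).2 rfl, trivial, rfl⟩, ?_⟩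
    simp only [RegOp.apply, Function.update_self, withPair_self]
    rw [((hQ.call m).1 _ _ hv).2 (m + 1) (by omega)]

theorem Prog.exists_computes_comp {f g : ℕ →. ℕ} {m : ℕ} {P Q : Prog}
    (hP : P.Computes m f) (hQ : Q.Computes m g) :
    ∃ R : Prog, R.Computes m (fun n => g n >>= f) := by
  refine ⟨.seq Q P, ?_, ?_⟩
  · rintro s t ⟨u, hu, ht⟩
    obtain ⟨h1, h2⟩ := hQ.1 _ _ hu
    obtain ⟨h3, h4⟩ := hP.1 _ _ ht
    exact ⟨Part.mem_bind_iff.2 ⟨_, h1, h3⟩, fun r hr => (h4 r hr).trans (h2 r hr)⟩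
  · intro s b hb
    obtain ⟨x, hx, hb⟩ := Part.mem_bind_iff.1 hb
    obtain ⟨u, hu, rfl⟩ := hQ.2 _ _ hx
    obtain ⟨t, ht, rfl⟩ := hP.2 _ _ hb
    exact ⟨t, ⟨u, hu, ht⟩, rfl⟩

theorem Prog.exists_computes_prec {f g : ℕ →. ℕ} {m : ℕ} {P Q : Prog}
    (hP : P.Computes (m + 5) f) (hQ : Q.Computes (m + 5) g) :
    ∃ R : Prog, R.Computes m (Nat.unpaired fun a n =>
      n.rec (f a) fun y IH => do let i ← IH; g (Nat.pair a (Nat.pair y i))) := by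
  let F : ℕ → ℕ → Part ℕ := fun a n =>
    n.rec (f a) fun y IH => do let i ← IH; g (Nat.pair a (Nat.pair y i))
  have F0 : ∀ a, F a 0 = f a := fun _ => rfl
  have FS : ∀ a y, F a (y + 1) = (F a y).bind fun i => g (Nat.pair a (Nat.pair y i)) :=
    fun _ _ => rfl
  -- Layout: `m + 2` holds the parameter, `m + 3` the number of rounds, `m + 4` the round counter
  -- and `m + 5` the current value. The registers from `m + 6` and `m + 9` on build the nested
  -- argument of `g`.
  let body : Prog := .seq (pairInto (m + 6) (m + 4) (m + 5)) <|
    .seq (pairInto (m + 9) (m + 2) (m + 6)) <| .seq (Q.call (m + 5) (m + 9)) (.op (.succ (m + 4)))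
  have body1 : ∀ s t, body.Exec s t → t (m + 4) = s (m + 4) + 1 ∧
      t (m + 5) ∈ g (Nat.pair (s (m + 2)) (Nat.pair (s (m + 4)) (s (m + 5)))) ∧
      ∀ r < m + 4, t r = s r := by
    rintro s t ⟨u, hu, v, hv, w, hw, -, rfl⟩
    rw [exec_pairInto (by omega) (by omega)] at hu hv
    obtain ⟨h1, h2⟩ := (hQ.call _).1 _ _ hw
    have h3 : ∀ r < m + 5, v r = s r := fun r hr => by
      rw [hv, withPair_of_lt _ _ (by omega), hu, withPair_of_lt _ _ (by omega)]
    have h4 : v (m + 9) = Nat.pair (s (m + 2)) (Nat.pair (s (m + 4)) (s (m + 5))) := by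
      rw [hv, withPair_self, hu, withPair_of_lt _ _ (by omega), withPair_self]
    refine ⟨?_, ?_, fun r hr => ?_⟩
    · simp only [RegOp.apply, Function.update_self]
      rw [h2 _ (by omega), h3 _ (by omega)]
    · rw [← h4]
      simpa [RegOp.apply] using h1
    · simp only [RegOp.apply]
      rw [Function.update_of_ne hr.ne, h2 _ (by omega), h3 _ (by omega)]
  have body2 : ∀ s, ∀ b ∈ g (Nat.pair (s (m + 2)) (Nat.pair (s (m + 4)) (s (m + 5)))),
      ∃ t, body.Exec s t ∧ t (m + 5) = b := by
    intro s b hb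
    let u := withPair s (m + 6) (Nat.pair (s (m + 4)) (s (m + 5)))
    let v := withPair u (m + 9) (Nat.pair (u (m + 2)) (u (m + 6)))
    have h4 : v (m + 9) = Nat.pair (s (m + 2)) (Nat.pair (s (m + 4)) (s (m + 5))) := by
      simp only [u, v]
      rw [withPair_self, withPair_of_lt _ _ (by omega), withPair_self]
    rw [← h4] at hb
    obtain ⟨w, hw, rfl⟩ := (hQ.call _).2 _ _ hb
    exact ⟨_, ⟨u, (exec_pairInto (by omega) (by omega)).2 rfl, v,
      (exec_pairInto (by omega) (by omega)).2 rfl, w, hw, trivial, rfl⟩, by simp [RegOp.apply]⟩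
  refine ⟨.seq (unpairInto (m + 1) m) <| .seq (.op (.zero (m + 4))) <|
    .seq (P.call (m + 5) (m + 2)) <| .seq (.star body) <| .seq (.op (.eq (m + 4) (m + 3)))
    (.op (.copy m (m + 5))), ?_, ?_⟩
  · rintro s t ⟨u, hu, v, ⟨-, rfl⟩, w, hw, x, hx, y, ⟨hy, rfl⟩, -, rfl⟩
    rw [exec_unpairInto (by omega)] at hu
    obtain ⟨h1, h2⟩ := (hP.call _).1 _ _ hw
    simp only [RegOp.apply] at h1 h2
    -- Loop invariant: the value register holds a result of the recursion after as many rounds as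
    -- the counter says. The test after the loop makes this number the required one.
    have inv : ∀ z, Relation.ReflTransGen body.Exec w z →
        z (m + 5) ∈ F (w (m + 2)) (z (m + 4)) ∧ ∀ r < m + 4, z r = w r := by
      intro z hz
      induction hz with
      | refl =>
        refine ⟨?_, fun _ _ => rfl⟩
        rw [h2 (m + 4) (by omega), Function.update_self, F0, h2 _ (by omega)]
        exact h1
      | tail _ h ih =>
        obtain ⟨b1, b2, b3⟩ := body1 _ _ h
        refine ⟨?_, fun r hr => (b3 r hr).trans (ih.2 r hr)⟩
        rw [b1, FS, Part.mem_bind_iff]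
        rw [ih.2 _ (by omega)] at b2
        exact ⟨_, ih.1, b2⟩
    obtain ⟨h3, h4⟩ := inv y hx
    have h5 : ∀ r < m + 4, w r = withPair s (m + 1) (s m) r := fun r hr => by
      rw [h2 r (by omega), Function.update_of_ne hr.ne, hu]
    simp only [RegOp.Guard] at hy
    refine ⟨?_, fun r hr => ?_⟩
    · simp only [RegOp.apply, Function.update_self]
      rw [hy, h4 _ (by omega), h5 _ (by omega), h5 _ (by omega), withPair_fst s (m + 1),
        withPair_snd s (m + 1)] at h3
      exact h3
    · simp only [RegOp.apply]
      rw [Function.update_of_ne hr.ne, h4 _ (by omega), h5 _ (by omega),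
        withPair_of_lt _ _ (by omega)]
  · intro s b hb
    change b ∈ F (s m).unpair.1 (s m).unpair.2 at hb
    let u := withPair s (m + 1) (s m)
    let v := Function.update u (m + 4) 0
    have hv : ∀ r < m + 4, v r = u r := fun r hr => Function.update_of_ne hr.ne _ _
    have key : ∀ n, ∀ b ∈ F (u (m + 2)) n, ∃ w x, (P.call (m + 5) (m + 2)).Exec v w ∧
        (Prog.star body).Exec w x ∧ x (m + 4) = n ∧ x (m + 5) = b ∧
        ∀ r < m + 4, x r = u r := by
      intro n
      induction n with
      | zero =>
        intro b hb
        rw [F0, ← hv _ (by omega)] at hb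
        obtain ⟨w, hw, rfl⟩ := (hP.call _).2 _ _ hb
        have h2 := ((hP.call _).1 _ _ hw).2
        refine ⟨w, w, hw, .refl, ?_, rfl, fun r hr => (h2 r (by omega)).trans (hv r hr)⟩
        rw [h2 _ (by omega)]
        exact Function.update_self _ _ _
      | succ n ih =>
        intro b hb
        rw [FS, Part.mem_bind_iff] at hb
        obtain ⟨i, hi, hb⟩ := hb
        obtain ⟨w, x, hw, hx, rfl, rfl, h3⟩ := ih i hi
        rw [← h3 _ (by omega)] at hb
        obtain ⟨y, hy, rfl⟩ := body2 x _ hb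
        obtain ⟨b1, b2, b3⟩ := body1 _ _ hy
        exact ⟨w, y, hw, .tail hx hy, b1, rfl, fun r hr => (b3 r hr).trans (h3 r hr)⟩
    have e1 : u (m + 2) = (s m).unpair.1 := withPair_fst s (m + 1) _
    have e2 : u (m + 3) = (s m).unpair.2 := withPair_snd s (m + 1) _
    rw [← e1] at hb
    obtain ⟨w, x, hw, hx, h1, rfl, h3⟩ := key _ b hb
    refine ⟨_, ⟨u, (exec_unpairInto (by omega)).2 rfl, v, ⟨trivial, rfl⟩, w, hw, x, hx, x,
      ⟨?_, rfl⟩, trivial, rfl⟩, Function.update_self _ _ _⟩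
    simp only [RegOp.Guard]
    rw [h1, h3 _ (by omega), e2]

theorem Prog.exists_computes_rfind {f : ℕ →. ℕ} {m : ℕ} {P : Prog}
    (hP : P.Computes (m + 2) f) :
    ∃ R : Prog, R.Computes m
      (fun a => Nat.rfind fun n => (fun k => decide (k = 0)) <$> f (Nat.pair a n)) := by
  let body : Prog := .seq (pairInto (m + 2) m (m + 1)) P
  have body1 : ∀ s t, body.Exec s t → t (m + 2) ∈ f (Nat.pair (s m) (s (m + 1))) ∧
      ∀ r < m + 2, t r = s r := by
    rintro s t ⟨u, hu, ht⟩
    rw [exec_pairInto (by omega) (by omega)] at hu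
    obtain ⟨h1, h2⟩ := hP.1 _ _ ht
    subst hu
    rw [withPair_self] at h1
    exact ⟨h1, fun r hr => (h2 r hr).trans (withPair_of_lt _ _ hr)⟩
  have body2 : ∀ s, ∀ b ∈ f (Nat.pair (s m) (s (m + 1))), ∃ t, body.Exec s t ∧ t (m + 2) = b := by
    intro s b hb
    obtain ⟨t, ht, h⟩ := hP.2 (withPair s (m + 2) (Nat.pair (s m) (s (m + 1)))) b
      (by rwa [withPair_self])
    exact ⟨t, ⟨_, (exec_pairInto (by omega) (by omega)).2 rfl, ht⟩, h⟩
  -- The candidate is in `m + 1` and the value of `f` in `m + 2`. A round passes only if this value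
  -- exceeds the zero put into `m + 3`, so the loop skips no root.
  let loop : Prog := .seq body <| .seq (.op (.zero (m + 3))) <|
    .seq (.op (.lt (m + 3) (m + 2))) (.op (.succ (m + 1)))
  have loop1 : ∀ s t, loop.Exec s t → t (m + 1) = s (m + 1) + 1 ∧ (∀ r < m + 1, t r = s r) ∧
      ∃ k ∈ f (Nat.pair (s m) (s (m + 1))), k ≠ 0 := by
    rintro s t ⟨u, hu, _, ⟨-, rfl⟩, _, ⟨hg, rfl⟩, -, rfl⟩
    obtain ⟨h1, h2⟩ := body1 _ _ hu
    refine ⟨?_, fun r hr => ?_, _, h1, ?_⟩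
    · simp [RegOp.apply, h2]
    · simp only [RegOp.apply]
      rw [Function.update_of_ne hr.ne, Function.update_of_ne (by omega), h2 r (by omega)]
    · simp only [RegOp.Guard, RegOp.apply, Function.update_self] at hg
      rw [Function.update_of_ne (by omega)] at hg
      omega
  have loop2 : ∀ s, (∃ k ∈ f (Nat.pair (s m) (s (m + 1))), k ≠ 0) → ∃ t, loop.Exec s t := by
    rintro s ⟨k, hk, hk0⟩
    obtain ⟨t, ht, rfl⟩ := body2 _ _ hk
    refine ⟨_, t, ht, _, ⟨trivial, rfl⟩, _, ⟨?_, rfl⟩, trivial, rfl⟩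
    simp only [RegOp.Guard, RegOp.apply, Function.update_self]
    rw [Function.update_of_ne (by omega)]
    omega
  refine ⟨.seq (.op (.zero (m + 1))) <| .seq (.star loop) <| .seq body <|
    .seq (.op (.isZero (m + 2))) (.op (.copy m (m + 1))), ?_, ?_⟩
  · rintro s t ⟨u, ⟨-, rfl⟩, v, hv, w, hw, _, ⟨hg, rfl⟩, -, rfl⟩
    have inv : ∀ z, Relation.ReflTransGen loop.Exec (Function.update s (m + 1) 0) z →
        (∀ r < m + 1, z r = s r) ∧
        ∀ n < z (m + 1), ∃ k ∈ f (Nat.pair (s m) n), k ≠ 0 := by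
      intro z hz
      induction hz with
      | refl => exact ⟨fun r hr => Function.update_of_ne hr.ne _ _, by simp⟩
      | tail _ h ih =>
        obtain ⟨l1, l2, l3⟩ := loop1 _ _ h
        refine ⟨fun r hr => (l2 r hr).trans (ih.1 r hr), fun n hn => ?_⟩
        rw [l1] at hn
        rcases Nat.lt_succ_iff_lt_or_eq.1 hn with h | rfl
        · exact ih.2 n h
        · rwa [ih.1 m (by omega)] at l3
    obtain ⟨h1, h2⟩ := inv v hv
    obtain ⟨h3, h4⟩ := body1 _ _ hw
    rw [h1 m (by omega)] at h3
    simp only [RegOp.Guard] at hg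
    refine ⟨?_, fun r hr => ?_⟩
    · simp only [RegOp.apply, Function.update_self]
      rw [h4 _ (by omega)]
      refine Nat.mem_rfind.2 ⟨?_, fun {n} hn => ?_⟩
      · rw [Part.map_eq_map, Part.mem_map_iff]
        exact ⟨_, h3, by simp [hg]⟩
      · obtain ⟨k, hk, hk0⟩ := h2 n hn
        rw [Part.map_eq_map, Part.mem_map_iff]
        exact ⟨_, hk, by simp [hk0]⟩
    · simp only [RegOp.apply]
      rw [Function.update_of_ne hr.ne, h4 _ (by omega), h1 _ (by omega)]
  · intro s b hb
    obtain ⟨hb, hlt⟩ := Nat.mem_rfind.1 hb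
    have key : ∀ n ≤ b, ∃ v, (Prog.star loop).Exec (Function.update s (m + 1) 0) v ∧
        v (m + 1) = n ∧ v m = s m := by
      intro n
      induction n with
      | zero => exact fun _ => ⟨_, .refl, by simp, by simp⟩
      | succ n ih =>
        intro hn
        obtain ⟨v, hv, rfl, h2⟩ := ih (by omega)
        have := hlt (m := v (m + 1)) (by omega)
        rw [Part.map_eq_map, Part.mem_map_iff] at this
        obtain ⟨k, hk, hk0⟩ := this
        obtain ⟨t, ht⟩ := loop2 v ⟨k, by rwa [h2], by simpa using hk0⟩
        obtain ⟨l1, l2, -⟩ := loop1 _ _ ht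
        exact ⟨t, .tail hv ht, l1, (l2 _ (by omega)).trans h2⟩
    obtain ⟨v, hv, rfl, h2⟩ := key b le_rfl
    rw [Part.map_eq_map, Part.mem_map_iff] at hb
    obtain ⟨k, hk, hk0⟩ := hb
    rw [← h2] at hk
    obtain ⟨t, ht, rfl⟩ := body2 _ _ hk
    refine ⟨_, ⟨_, ⟨trivial, rfl⟩, v, hv, t, ht, t, ⟨by simpa [RegOp.Guard] using hk0, rfl⟩,
      trivial, rfl⟩, ?_⟩
    simp only [RegOp.apply, Function.update_self]
    exact (body1 _ _ ht).2 _ (by omega)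

/-- Every partial recursive function is computed by a regular program. -/
theorem Prog.exists_computes {f : ℕ →. ℕ} (hf : Nat.Partrec f) :
    ∀ m, ∃ P : Prog, P.Computes m f := by
  induction hf with
  | zero =>
    refine fun m => ⟨.op (.zero m), .of_fun (f := fun _ => 0)
      (fun s => Function.update s m 0) ?_ ?_ ?_⟩
    · simp [Exec, RegOp.Guard, RegOp.apply]
    · simp
    · exact fun s r hr => Function.update_of_ne hr.ne _ _
  | succ =>
    refine fun m => ⟨.op (.succ m), .of_fun (fun s => Function.update s m (s m + 1)) ?_ ?_ ?_⟩
    · simp [Exec, RegOp.Guard, RegOp.apply]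
    · simp
    · exact fun s r hr => Function.update_of_ne hr.ne _ _
  | left => exact exists_computes_left
  | right => exact exists_computes_right
  | pair _ _ ihf ihg =>
    intro m
    obtain ⟨P, hP⟩ := ihf (m + 1)
    obtain ⟨Q, hQ⟩ := ihg (m + 2)
    exact exists_computes_pair hP hQ
  | comp _ _ ihf ihg =>
    intro m
    obtain ⟨P, hP⟩ := ihf m
    obtain ⟨Q, hQ⟩ := ihg m
    exact exists_computes_comp hP hQ
  | prec _ _ ihf ihg =>
    intro m
    obtain ⟨P, hP⟩ := ihf (m + 5)
    obtain ⟨Q, hQ⟩ := ihg (m + 5)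
    exact exists_computes_prec hP hQ
  | rfind _ ih =>
    intro m
    obtain ⟨P, hP⟩ := ih (m + 2)
    exact exists_computes_rfind hP

/-! ### From programs to finite lists of rules -/

/-- One step of the transition system given by a list of rules `(p, o, q)`: the operation `o` is
performed while moving from control state `p` to control state `q`. -/
def RuleStep {σ : Type} (T : List (σ × RegOp × σ)) (x y : σ × (ℕ → ℕ)) : Prop :=
  ∃ o : RegOp, (x.1, o, y.1) ∈ T ∧ o.Guard x.2 ∧ y.2 = o.apply x.2

/-- `eq 0 0` is always enabled and changes nothing; it serves as the silent move of the control. -/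
theorem RuleStep.skip {σ : Type} {T : List (σ × RegOp × σ)} {p q : σ}
    (h : (p, RegOp.eq 0 0, q) ∈ T) (s : ℕ → ℕ) : RuleStep T (p, s) (q, s) :=
  ⟨.eq 0 0, h, rfl, rfl⟩

/-- The rules of a program. A control state is the list of programs that remain to be run. -/
def Prog.rules : Prog → List Prog → List (List Prog × RegOp × List Prog)
  | .op o, K => [(.op o :: K, o, K)]
  | .seq p q, K => (.seq p q :: K, .eq 0 0, p :: q :: K) :: (p.rules (q :: K) ++ q.rules K)
  | .alt p q, K => (.alt p q :: K, .eq 0 0, p :: K) :: (.alt p q :: K, .eq 0 0, q :: K) ::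
      (p.rules K ++ q.rules K)
  | .star p, K => (.star p :: K, .eq 0 0, K) :: (.star p :: K, .eq 0 0, p :: .star p :: K) ::
      p.rules (.star p :: K)

theorem Prog.Exec.ruleStep {T : List (List Prog × RegOp × List Prog)} (P : Prog) :
    ∀ (K : List Prog) (s t : ℕ → ℕ), P.rules K ⊆ T → P.Exec s t →
      Relation.ReflTransGen (RuleStep T) (P :: K, s) (K, t) := by
  induction P with
  | op o =>
    rintro K s t hT ⟨h, rfl⟩
    exact .single ⟨o, hT (by simp [rules]), h, rfl⟩
  | seq p q ihp ihq =>
    rintro K s t hT ⟨u, hu, ht⟩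
    simp only [rules, List.cons_subset, List.append_subset] at hT
    exact .head (.skip hT.1 s) ((ihp _ _ _ hT.2.1 hu).trans (ihq _ _ _ hT.2.2 ht))
  | alt p q ihp ihq =>
    rintro K s t hT h
    simp only [rules, List.cons_subset, List.append_subset] at hT
    rcases h with h | h
    · exact .head (.skip hT.1 s) (ihp _ _ _ hT.2.2.1 h)
    · exact .head (.skip hT.2.1 s) (ihq _ _ _ hT.2.2.2 h)
  | star p ih =>
    intro K s t hT h
    simp only [rules, List.cons_subset] at hT
    simp only [Exec] at h
    induction h using Relation.ReflTransGen.head_induction_on with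
    | refl => exact .single (.skip hT.1 _)
    | head h _ ih' => exact .head (.skip hT.2.1 _) ((ih _ _ _ hT.2.2 h).trans ih')

/-- Input-output relation of a list of programs, run one after the other. -/
def ExecList : List Prog → (ℕ → ℕ) → (ℕ → ℕ) → Prop
  | [], s, t => s = t
  | P :: K, s, t => ∃ u, P.Exec s u ∧ ExecList K u t

/-- A control state is read as the continuation still to be executed. Each rule preserves this
reading backwards, so a run can be analysed step by step from its end, without being cut into runs
of subprograms. -/
theorem Prog.execList_of_mem_rules (P : Prog) : ∀ (K : List Prog),
    ∀ r ∈ P.rules K, ∀ s t : ℕ → ℕ, r.2.1.Guard s → ExecList r.2.2 (r.2.1.apply s) t →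
      ExecList r.1 s t := by
  induction P with
  | op o =>
    intro K r hr s t hg h
    simp only [rules, List.mem_singleton] at hr
    subst hr
    exact ⟨_, ⟨hg, rfl⟩, h⟩
  | seq p q ihp ihq =>
    intro K r hr s t hg h
    simp only [rules, List.mem_cons, List.mem_append] at hr
    rcases hr with rfl | hr | hr
    · obtain ⟨u, hu, v, hv, h⟩ := h
      exact ⟨v, ⟨u, hu, hv⟩, h⟩
    · exact ihp _ _ hr _ _ hg h
    · exact ihq _ _ hr _ _ hg h
  | alt p q ihp ihq =>
    intro K r hr s t hg h
    simp only [rules, List.mem_cons, List.mem_append] at hr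
    rcases hr with rfl | rfl | hr | hr
    · obtain ⟨u, hu, h⟩ := h
      exact ⟨u, .inl hu, h⟩
    · obtain ⟨u, hu, h⟩ := h
      exact ⟨u, .inr hu, h⟩
    · exact ihp _ _ hr _ _ hg h
    · exact ihq _ _ hr _ _ hg h
  | star p ih =>
    intro K r hr s t hg h
    simp only [rules, List.mem_cons] at hr
    rcases hr with rfl | rfl | hr
    · exact ⟨s, .refl, h⟩
    · obtain ⟨u, hu, v, hv, h⟩ := h
      exact ⟨v, .head hu hv, h⟩
    · exact ih _ _ hr _ _ hg h

theorem RuleStep.map {σ ρ : Type} {T : List (σ × RegOp × σ)} (e : σ → ρ) {x y : σ × (ℕ → ℕ)}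
    (h : Relation.ReflTransGen (RuleStep T) x y) :
    Relation.ReflTransGen (RuleStep (T.map fun r => (e r.1, r.2.1, e r.2.2)))
      (e x.1, x.2) (e y.1, y.2) :=
  h.lift (fun z : σ × (ℕ → ℕ) => (e z.1, z.2)) fun _ _ ⟨o, ho, h⟩ =>
    ⟨o, List.mem_map.2 ⟨_, ho, rfl⟩, h⟩

/-- The naming `e` of control states need not be computable: a single program is compiled, once and
for all, and only its input varies. -/
theorem Prog.exec_iff_ruleStep (P : Prog) (e : List Prog → ℕ) (he : Function.Injective e)
    (s t : ℕ → ℕ) : P.Exec s t ↔ Relation.ReflTransGen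
      (RuleStep ((P.rules []).map fun r => (e r.1, r.2.1, e r.2.2))) (e [P], s) (e [], t) := by
  constructor
  · exact fun h => RuleStep.map e (h.ruleStep P [] s t (List.Subset.refl _))
  · intro h
    have key : ∀ x : ℕ × (ℕ → ℕ), Relation.ReflTransGen
        (RuleStep ((P.rules []).map fun r => (e r.1, r.2.1, e r.2.2))) x (e [], t) →
        ∀ K, x.1 = e K → ExecList K x.2 t := by
      intro x hx
      induction hx using Relation.ReflTransGen.head_induction_on with
      | refl =>
        intro K hK
        obtain rfl := he hK
        rfl
      | head h _ ih =>
        rintro K hK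
        obtain ⟨o, ho, hg, ha⟩ := h
        obtain ⟨r, hr, hro⟩ := List.mem_map.1 ho
        simp only [Prod.mk.injEq] at hro
        obtain ⟨h1, rfl, h2⟩ := hro
        obtain rfl := he (h1.trans hK)
        refine P.execList_of_mem_rules _ r hr _ _ hg ?_
        rw [← ha]
        exact ih _ h2.symm
    obtain ⟨u, hu, rfl⟩ := key _ h [P] rfl
    exact hu

/-! ### An undecidable reachability problem -/

/-- The store with `a` in register `0` and zero everywhere else. -/
def inputStore (a : ℕ) : ℕ → ℕ := fun d => if d = 0 then a else 0

theorem exists_partrec_dom_not_computable :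
    ∃ f : ℕ →. ℕ, Nat.Partrec f ∧ ¬ ComputablePred fun a => (f a).Dom := by
  refine ⟨fun a => (Nat.Partrec.Code.ofNatCode a).eval 0, ?_, fun h => ?_⟩
  · exact Partrec.nat_iff.1 (Nat.Partrec.Code.eval_part.comp
      (Computable.ofNat Nat.Partrec.Code) (Computable.const 0))
  · refine ComputablePred.halting_problem 0 ?_
    refine ComputablePred.computable_of_manyOneReducible
      ⟨Encodable.encode, Computable.encode, fun c => ?_⟩ h
    change _ ↔ ((Denumerable.ofNat Nat.Partrec.Code (Encodable.encode c)).eval 0).Dom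
    rw [Denumerable.ofNat_encode]

/-- There is a transition system on registers whose reachability problem is undecidable. -/
theorem exists_rules_not_computable : ∃ (T : List (ℕ × RegOp × ℕ)) (p q : ℕ),
    ¬ ComputablePred fun a : ℕ =>
      ∃ t, Relation.ReflTransGen (RuleStep T) (p, inputStore a) (q, t) := by
  obtain ⟨f, hf, hd⟩ := exists_partrec_dom_not_computable
  obtain ⟨P, hP⟩ := Prog.exists_computes hf 0
  obtain ⟨e, he⟩ := exists_injective_nat (List Prog)
  refine ⟨(P.rules []).map fun r => (e r.1, r.2.1, e r.2.2), e [P], e [],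
    fun h => hd (h.of_eq fun a => ?_)⟩
  · simp only [← Prog.exec_iff_ruleStep P e he]
    constructor
    · rintro ⟨t, ht⟩
      exact Part.dom_iff_mem.2 ⟨_, (hP.1 _ _ ht).1⟩
    · intro hdom
      obtain ⟨b, hb⟩ := Part.dom_iff_mem.1 hdom
      obtain ⟨t, ht, -⟩ := hP.2 (inputStore a) b hb
      exact ⟨t, ht⟩

variable {n : ℕ}

/-! ### Formulas over negated constraints -/

/-- The negated gap-order constraint `a - b < c`. -/
def Property.ltc (a b : GCTerm n) (c : ℕ) : Property n := .not (.atom (a, b, c))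

/-- The equation `a = b + c`, for `c ≤ 1`. -/
def Property.eqc (a b : GCTerm n) (c : ℕ) : Property n := .and (.ltc a b (c + 1)) (.ltc b a (1 - c))

/-- Disjunction. -/
def Property.or (φ ψ : Property n) : Property n := .not (.and (.not φ) (.not ψ))

/-- Conjunction of a list of properties. -/
def Property.conj (l : List (Property n)) : Property n :=
  l.foldr .and (.ltc (.inr 0) (.inr 0) 1)

/-- Disjunction of a list of properties. -/
def Property.disj (l : List (Property n)) : Property n :=
  l.foldr .or (.ltc (.inr 0) (.inr 0) 0)

section Semantics

variable {τ : Trace n} {i : ℕ}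

/-- A constraint that looks past the end is true, so its negation excludes this case. Negated
constraints thereby force the next configuration to be present in the trace. -/
theorem holdsAt_ltc (hi : i < τ.length) (a b : GCTerm n) (c : ℕ) :
    HoldsAt τ i (.ltc a b c) ↔ (i + a.lookahead < τ.length ∧ i + b.lookahead < τ.length) ∧
      a.value τ i < b.value τ i + c := by
  simp only [Property.ltc, HoldsAt, GapConstraint.WellDefined, hi, true_and, not_or, not_not]
  refine and_congr_right fun _ => ?_
  omega

/-- The second bound is `b - a < 1 - c`, whose right side must be a natural number; hence `c ≤ 1`.
This is just enough for unit increments and decrements. -/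
theorem holdsAt_eqc (hi : i < τ.length) (a b : GCTerm n) {c : ℕ} (hc : c ≤ 1) :
    HoldsAt τ i (.eqc a b c) ↔ (i + a.lookahead < τ.length ∧ i + b.lookahead < τ.length) ∧
      a.value τ i = b.value τ i + c := by
  simp only [Property.eqc, HoldsAt, holdsAt_ltc hi]
  constructor
  · rintro ⟨⟨h, h1⟩, -, h2⟩
    exact ⟨h, by omega⟩
  · rintro ⟨h, h1⟩
    exact ⟨⟨h, by omega⟩, h.symm, by omega⟩

theorem holdsAt_or (φ ψ : Property n) :
    HoldsAt τ i (.or φ ψ) ↔ HoldsAt τ i φ ∨ HoldsAt τ i ψ := by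
  simp only [Property.or, HoldsAt]
  tauto

theorem holdsAt_true (hi : i < τ.length) : HoldsAt τ i (.ltc (.inr 0) (.inr 0) 1) := by
  simp [holdsAt_ltc hi, GCTerm.lookahead, GCTerm.value, hi]

theorem holdsAt_conj (hi : i < τ.length) (l : List (Property n)) :
    HoldsAt τ i (.conj l) ↔ ∀ φ ∈ l, HoldsAt τ i φ := by
  induction l with
  | nil => simpa [Property.conj] using holdsAt_true hi
  | cons φ l ih =>
    rw [List.forall_mem_cons, ← ih]
    rfl

theorem holdsAt_disj (hi : i < τ.length) (l : List (Property n)) :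
    HoldsAt τ i (.disj l) ↔ ∃ φ ∈ l, HoldsAt τ i φ := by
  induction l with
  | nil => simp [Property.disj, holdsAt_ltc hi, GCTerm.value]
  | cons φ l ih =>
    rw [List.exists_mem_cons_iff, ← ih]
    exact holdsAt_or _ _

end Semantics

section Polarity

theorem Property.hasPolarity_eqc (a b : GCTerm n) (c : ℕ) : HasPolarity false (.eqc a b c) :=
  ⟨rfl, rfl⟩

theorem Property.hasPolarity_conj (l : List (Property n)) (h : ∀ φ ∈ l, HasPolarity false φ) :
    HasPolarity false (.conj l) := by
  induction l with
  | nil => rfl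
  | cons φ l ih =>
    rw [List.forall_mem_cons] at h
    exact ⟨h.1, ih h.2⟩

theorem Property.hasPolarity_disj (l : List (Property n)) (h : ∀ φ ∈ l, HasPolarity false φ) :
    HasPolarity false (.disj l) := by
  induction l with
  | nil => rfl
  | cons φ l ih =>
    rw [List.forall_mem_cons] at h
    exact ⟨h.1, ih h.2⟩

end Polarity

/-! ### Runs written on traces -/

/-- The registers below the bound are the only ones that the operation reads or changes. -/
def RegOp.bound : RegOp → ℕ
  | .succ r => r + 1
  | .dec r => r + 1
  | .zero r => r + 1
  | .copy r x => max r x + 1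
  | .isZero r => r + 1
  | .eq x y => max x y + 1
  | .lt x y => max x y + 1

/-- The variable `v` at the `k + 1` instants from `i` on describes the configuration with control
state `p` (coded by a negative number) and store `s`, of which the first `k` registers are
listed. -/
def IsBlock (v : Fin n) (k : ℕ) (τ : Trace n) (i p : ℕ) (s : ℕ → ℕ) : Prop :=
  i + k < τ.length ∧ τ.getD i 0 v = Int.negSucc p ∧ ∀ d < k, τ.getD (i + (1 + d)) 0 v = (s d : ℤ)

/-- The property that a block with control state `p` and store `s` begins. -/
def initProp (v : Fin n) (k p : ℕ) (s : ℕ → ℕ) : Property n :=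
  .and (.eqc (.inl (v, 0)) (.inr (Int.negSucc p)) 0)
    (.conj ((List.range k).map fun d => .eqc (.inl (v, 1 + d)) (.inr (s d : ℤ)) 0))

/-- The property that an operation is enabled in the block that begins. -/
def guardProp (v : Fin n) : RegOp → Property n
  | .dec r => .ltc (.inr 0) (.inl (v, 1 + r)) 0
  | .isZero r => .eqc (.inl (v, 1 + r)) (.inr 0) 0
  | .eq x y => .eqc (.inl (v, 1 + x)) (.inl (v, 1 + y)) 0
  | .lt x y => .ltc (.inl (v, 1 + x)) (.inl (v, 1 + y)) 0
  | _ => .ltc (.inr 0) (.inr 0) 1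

/-- The property that the value of register `d` in the next block is the one after an operation
on the present block. -/
def linkProp (v : Fin n) (k : ℕ) (o : RegOp) (d : ℕ) : Property n :=
  let keep : Property n := .eqc (.inl (v, k + 1 + (1 + d))) (.inl (v, 1 + d)) 0
  match o with
  | .succ r => if d = r then .eqc (.inl (v, k + 1 + (1 + d))) (.inl (v, 1 + d)) 1 else keep
  | .dec r => if d = r then .eqc (.inl (v, 1 + d)) (.inl (v, k + 1 + (1 + d))) 1 else keep
  | .zero r => if d = r then .eqc (.inl (v, k + 1 + (1 + d))) (.inr 0) 0 else keep
  | .copy r x => if d = r then .eqc (.inl (v, k + 1 + (1 + d))) (.inl (v, 1 + x)) 0 else keep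
  | _ => keep

/-- The property that the next block arises from the present one by an operation. -/
def opProp (v : Fin n) (k : ℕ) (o : RegOp) : Property n :=
  .and (guardProp v o) (.conj ((List.range k).map (linkProp v k o)))

/-- The property that the next block arises from the present one by a rule. -/
def ruleProp (v : Fin n) (k : ℕ) (r : ℕ × RegOp × ℕ) : Property n :=
  .and (.eqc (.inl (v, 0)) (.inr (Int.negSucc r.1)) 0)
    (.and (.eqc (.inl (v, k + 1)) (.inr (Int.negSucc r.2.2)) 0) (opProp v k r.2.1))

/-- The property that a run begins that leads to control state `q`. -/
def reachProp (v : Fin n) (k : ℕ) (T : List (ℕ × RegOp × ℕ)) (q : ℕ) : Property n :=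
  .untl (.or (.ltc (.inr 0) (.inl (v, 0)) 1) (.disj (T.map (ruleProp v k))))
    (.eqc (.inl (v, 0)) (.inr (Int.negSucc q)) 0)

theorem hasPolarity_initProp (v : Fin n) (k p : ℕ) (s : ℕ → ℕ) :
    HasPolarity false (initProp v k p s) := by
  refine ⟨Property.hasPolarity_eqc _ _ _, Property.hasPolarity_conj _ fun φ hφ => ?_⟩
  obtain ⟨d, -, rfl⟩ := List.mem_map.1 hφ
  exact Property.hasPolarity_eqc _ _ _

theorem hasPolarity_opProp (v : Fin n) (k : ℕ) (o : RegOp) : HasPolarity false (opProp v k o) := by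
  refine ⟨?_, Property.hasPolarity_conj _ fun φ hφ => ?_⟩
  · cases o <;> first | exact Property.hasPolarity_eqc _ _ _ | rfl
  · obtain ⟨d, -, rfl⟩ := List.mem_map.1 hφ
    cases o <;> simp only [linkProp] <;> (try split_ifs) <;> exact Property.hasPolarity_eqc _ _ _

theorem hasPolarity_reachProp (v : Fin n) (k : ℕ) (T : List (ℕ × RegOp × ℕ)) (q : ℕ) :
    HasPolarity false (reachProp v k T q) := by
  refine ⟨⟨rfl, Property.hasPolarity_disj _ fun φ hφ => ?_⟩, Property.hasPolarity_eqc _ _ _⟩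
  obtain ⟨r, -, rfl⟩ := List.mem_map.1 hφ
  exact ⟨Property.hasPolarity_eqc _ _ _, Property.hasPolarity_eqc _ _ _, hasPolarity_opProp _ _ _⟩

section Blocks

variable {v : Fin n} {k : ℕ} {τ : Trace n} {i p : ℕ} {s : ℕ → ℕ}

theorem holdsAt_initProp (hi : i < τ.length) :
    HoldsAt τ i (initProp v k p s) ↔ IsBlock v k τ i p s := by
  simp only [initProp, HoldsAt, holdsAt_conj hi, List.forall_mem_map, List.mem_range,
    holdsAt_eqc hi _ _ (Nat.zero_le 1), GCTerm.lookahead, GCTerm.value, Nat.cast_zero, add_zero,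
    hi, true_and, and_true, IsBlock]
  constructor
  · rintro ⟨h1, h2⟩
    refine ⟨?_, h1, fun d hd => (h2 d hd).2⟩
    -- The length bound comes from the lookahead of the last register, or from the instant `i`
    -- itself if there are no registers.
    rcases Nat.eq_zero_or_pos k with rfl | hk
    · exact hi
    · have := (h2 (k - 1) (by omega)).1
      omega
  · rintro ⟨h1, h2, h3⟩
    exact ⟨h2, fun d hd => ⟨by omega, h3 d hd⟩⟩

theorem IsBlock.lt_length (h : IsBlock v k τ i p s) : i < τ.length := by
  have := h.1
  omega

theorem IsBlock.lt_length' (h : IsBlock v k τ i p s) {d : ℕ} (hd : d < k) :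
    i + (1 + d) < τ.length := by
  have := h.1
  omega

theorem IsBlock.holdsAt_guardProp (h : IsBlock v k τ i p s) {o : RegOp} (ho : o.bound ≤ k) :
    HoldsAt τ i (guardProp v o) ↔ o.Guard s := by
  have hi := h.lt_length
  cases o <;> simp only [RegOp.bound] at ho <;>
    simp only [guardProp, RegOp.Guard, holdsAt_true hi, holdsAt_ltc hi,
      holdsAt_eqc hi _ _ (Nat.zero_le 1), GCTerm.lookahead, GCTerm.value, Nat.cast_zero, add_zero,
      hi, true_and, and_true]
  case dec r | isZero r =>
    rw [h.2.2 r (by omega)]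
    simp [h.lt_length' (show r < k by omega)]
  case eq x y | lt x y =>
    rw [h.2.2 x (by omega), h.2.2 y (by omega)]
    simp [h.lt_length' (show x < k by omega), h.lt_length' (show y < k by omega)]

theorem IsBlock.holdsAt_linkProp (h : IsBlock v k τ i p s) {o : RegOp} (ho : o.bound ≤ k)
    (hg : o.Guard s) {d : ℕ} (hd : d < k) :
    HoldsAt τ i (linkProp v k o d) ↔ i + (k + 1) + (1 + d) < τ.length ∧
      τ.getD (i + (k + 1) + (1 + d)) 0 v = (o.apply s d : ℤ) := by
  have hi := h.lt_length
  have e : i + (k + 1 + (1 + d)) = i + (k + 1) + (1 + d) := by omega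
  have hl := h.lt_length' hd
  have hv := h.2.2 d hd
  cases o <;> simp only [RegOp.bound] at ho <;> simp only [linkProp] <;> try split_ifs with hr
  all_goals
    simp only [holdsAt_eqc hi _ _ (Nat.zero_le 1), holdsAt_eqc hi _ _ (le_refl 1),
      GCTerm.lookahead, GCTerm.value, RegOp.apply, e, hl, hv, Nat.cast_zero, Nat.cast_one,
      add_zero, and_true, true_and, hi]
  · subst hr
    simp
  · rw [Function.update_of_ne hr]
  · subst hr
    -- The formula says that the old value is the new one plus `1`. By the guard the old value is
    -- positive, so this agrees with truncated subtraction.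
    simp only [RegOp.Guard] at hg
    rw [Function.update_self]
    exact and_congr_right fun _ => by omega
  · rw [Function.update_of_ne hr]
  · subst hr
    simp
  · rw [Function.update_of_ne hr]
  · rename_i x
    subst hr
    rw [h.2.2 x (by omega), Function.update_self]
    simp [h.lt_length' (show x < k by omega)]
  · rw [Function.update_of_ne hr]

theorem IsBlock.holdsAt_opProp (h : IsBlock v k τ i p s) {o : RegOp} (ho : o.bound ≤ k) :
    HoldsAt τ i (opProp v k o) ↔ o.Guard s ∧ ∀ d < k, i + (k + 1) + (1 + d) < τ.length ∧
      τ.getD (i + (k + 1) + (1 + d)) 0 v = (o.apply s d : ℤ) := by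
  simp only [opProp, HoldsAt, h.holdsAt_guardProp ho, holdsAt_conj h.lt_length,
    List.forall_mem_map, List.mem_range]
  exact and_congr_right fun hg => forall₂_congr fun d hd => h.holdsAt_linkProp ho hg hd

theorem IsBlock.holdsAt_ruleProp (h : IsBlock v k τ i p s) {r : ℕ × RegOp × ℕ}
    (ho : r.2.1.bound ≤ k) : HoldsAt τ i (ruleProp v k r) ↔
      r.1 = p ∧ r.2.1.Guard s ∧ IsBlock v k τ (i + (k + 1)) r.2.2 (r.2.1.apply s) := by
  have hi := h.lt_length
  simp only [ruleProp, HoldsAt, h.holdsAt_opProp ho, holdsAt_eqc hi _ _ (Nat.zero_le 1),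
    GCTerm.lookahead, GCTerm.value, Nat.cast_zero, add_zero, hi, h.2.1, and_true, true_and,
    Int.negSucc_inj, IsBlock]
  constructor
  · rintro ⟨h1, ⟨h2, h3⟩, h4, h5⟩
    refine ⟨h1.symm, h4, ?_, h3, fun d hd => (h5 d hd).2⟩
    rcases Nat.eq_zero_or_pos k with rfl | hk
    · exact h2
    · have := (h5 (k - 1) (by omega)).1
      omega
  · rintro ⟨h1, h4, h2, h3, h5⟩
    exact ⟨h1.symm, ⟨by omega, h3⟩, h4, fun d hd => ⟨by omega, h5 d hd⟩⟩

theorem IsBlock.nonneg (h : IsBlock v k τ i p s) {d : ℕ} (hd : d < k) :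
    ∀ q, τ.getD (i + (1 + d)) 0 v ≠ Int.negSucc q := by
  intro q
  rw [h.2.2 d hd]
  omega

theorem holdsAt_stateProp (hi : i < τ.length) (q : ℕ) :
    HoldsAt τ i (.eqc (.inl (v, 0)) (.inr (Int.negSucc q)) 0) ↔
      τ.getD i 0 v = Int.negSucc q := by
  simp [holdsAt_eqc hi, GCTerm.lookahead, GCTerm.value, hi]

theorem holdsAt_nonneg (hi : i < τ.length) :
    HoldsAt τ i (.ltc (.inr 0) (.inl (v, 0)) 1) ↔ 0 ≤ τ.getD i 0 v := by
  simp [holdsAt_ltc hi, GCTerm.lookahead, GCTerm.value, hi]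

/-- A trace on which the reachability property holds contains a run. -/
theorem exists_run_of_holdsAt {T : List (ℕ × RegOp × ℕ)} (hT : ∀ r ∈ T, r.2.1.bound ≤ k) {q : ℕ}
    (h : IsBlock v k τ i p s) (hr : HoldsAt τ i (reachProp v k T q)) :
    ∃ t, Relation.ReflTransGen (RuleStep T) (p, s) (q, t) := by
  obtain ⟨j, hij, hj, hq, hall⟩ := hr
  rw [holdsAt_stateProp hj] at hq
  induction hm : j - i using Nat.strong_induction_on generalizing i p s with
  | _ m ih =>
    rcases Nat.eq_or_lt_of_le hij with rfl | hlt
    · rw [h.2.1, Int.negSucc_inj] at hq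
      subst hq
      exact ⟨s, .refl⟩
    · have hi := hall i le_rfl hlt
      rw [holdsAt_or, holdsAt_nonneg h.lt_length, h.2.1, holdsAt_disj h.lt_length] at hi
      rcases hi with hi | ⟨φ, hφ, hi⟩
      -- The head of a block is negative, so only the disjunct for a rule can hold there.
      · exact absurd hi (by omega)
      obtain ⟨r, hrT, rfl⟩ := List.mem_map.1 hφ
      obtain ⟨rfl, hg, hb⟩ := (h.holdsAt_ruleProp (hT r hrT)).1 hi
      -- The goal instant carries a negative value and the registers are nonnegative, so it cannot
      -- lie strictly inside the block.
      have hk : i + (k + 1) ≤ j := by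
        by_contra hk
        refine h.nonneg (d := j - i - 1) (by omega) q ?_
        rwa [show i + (1 + (j - i - 1)) = j by omega]
      obtain ⟨t, ht⟩ := ih (j - (i + (k + 1))) (by omega) hb hk
        (fun l h1 h2 => hall l (by omega) h2) rfl
      exact ⟨t, .head ⟨r.2.1, hrT, hg, rfl⟩ ht⟩

end Blocks

/-- The trace that consists of one block. -/
def blockTrace (n k p : ℕ) (s : ℕ → ℕ) : Trace n :=
  (fun _ => Int.negSucc p) :: (List.range k).map fun d _ => (s d : ℤ)

theorem length_blockTrace (k p : ℕ) (s : ℕ → ℕ) : (blockTrace n k p s).length = k + 1 := by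
  simp [blockTrace]

theorem isBlock_blockTrace (v : Fin n) (k p : ℕ) (s : ℕ → ℕ) (L L' : Trace n) :
    IsBlock v k (L ++ (blockTrace n k p s ++ L')) L.length p s := by
  refine ⟨?_, ?_, fun d hd => ?_⟩
  · simp [length_blockTrace]
    omega
  · rw [List.getD_append_right _ _ _ _ le_rfl, Nat.sub_self]
    rfl
  · rw [List.getD_append_right _ _ _ _ (by omega), Nat.add_sub_cancel_left,
      List.getD_append _ _ _ _ (by rw [length_blockTrace]; omega), Nat.add_comm, blockTrace,
      List.getD_cons_succ, List.getD_eq_getElem _ _ (by simpa using hd)]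
    simp

/-- A run yields a trace on which the reachability property holds. -/
theorem exists_trace_of_run (v : Fin n) {k : ℕ} {T : List (ℕ × RegOp × ℕ)}
    (hT : ∀ r ∈ T, r.2.1.bound ≤ k) {x y : ℕ × (ℕ → ℕ)}
    (h : Relation.ReflTransGen (RuleStep T) x y) :
    ∃ L' : Trace n, ∀ L : Trace n,
      HoldsAt (L ++ (blockTrace n k x.1 x.2 ++ L')) L.length (reachProp v k T y.1) := by
  induction h using Relation.ReflTransGen.head_induction_on with
  | refl =>
    refine ⟨[], fun L => ?_⟩
    have hb := isBlock_blockTrace v k y.1 y.2 L []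
    refine ⟨L.length, le_rfl, hb.lt_length, ?_, fun l h1 h2 => absurd h1 (by omega)⟩
    exact (holdsAt_stateProp hb.lt_length _).2 hb.2.1
  | @head x z hxz _ ih =>
    obtain ⟨o, ho, hg, hz⟩ := hxz
    obtain ⟨L', hL'⟩ := ih
    refine ⟨blockTrace n k z.1 z.2 ++ L', fun L => ?_⟩
    have hb := isBlock_blockTrace v k x.1 x.2 L (blockTrace n k z.1 z.2 ++ L')
    have hb' := isBlock_blockTrace v k z.1 z.2 (L ++ blockTrace n k x.1 x.2) L'
    -- The continuation does not depend on the prefix, so the present block can be absorbed into the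
    -- prefix.
    have hn := hL' (L ++ blockTrace n k x.1 x.2)
    rw [List.append_assoc, List.length_append, length_blockTrace] at hn hb'
    obtain ⟨j, hij, hj, hq, hall⟩ := hn
    refine ⟨j, by omega, hj, hq, fun l h1 h2 => ?_⟩
    -- In the new block the head satisfies the rule and the other instants are nonnegative; later
    -- instants are covered by the induction.
    rcases Nat.lt_or_ge l (L.length + (k + 1)) with hl | hl
    · rw [holdsAt_or]
      rcases Nat.eq_or_lt_of_le h1 with rfl | h1
      · refine .inr ((holdsAt_disj hb.lt_length _).2
          ⟨_, List.mem_map.2 ⟨_, ho, rfl⟩, (hb.holdsAt_ruleProp (hT _ ho)).2 ⟨rfl, hg, ?_⟩⟩)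
        dsimp only
        rwa [hz] at hb' ⊢
      · refine .inl ((holdsAt_nonneg (h2.trans hj)).2 ?_)
        have := hb.2.2 (l - L.length - 1) (by omega)
        rw [show L.length + (1 + (l - L.length - 1)) = l by omega] at this
        rw [this]
        exact Int.natCast_nonneg _
    · exact hall l hl h2

/-! ### Counter machines as register systems -/

section Counters

/-- The register operation for an operation of a counter machine on a given counter. -/
def CounterOp.toRegOp (c : Fin 2) : CounterOp → RegOp
  | .inc => .succ c
  | .dec => .dec c
  | .isZero => .isZero c

/-- The rule for a transition of a counter machine. -/
def counterRule (r : CounterTransition) : ℕ × RegOp × ℕ := (r.1, r.2.2.1.toRegOp r.2.1, r.2.2.2)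

theorem CounterOp.toRegOp_iff (c : Fin 2) (o : CounterOp) (s t : ℕ → ℕ) :
    ((o.toRegOp c).Guard s ∧ t = (o.toRegOp c).apply s) ↔
      o.Effect (s c) (t c) ∧ ∀ d : ℕ, d ≠ c → t d = s d := by
  cases o <;> simp only [toRegOp, RegOp.Guard, RegOp.apply, Effect, true_and]
  · exact Function.eq_update_iff
  · rw [Function.eq_update_iff, and_assoc]
  · rw [and_assoc]
    refine and_congr_right fun _ => ⟨fun h => h ▸ ⟨rfl, fun _ _ => rfl⟩,
      fun h => funext fun d => ?_⟩
    by_cases hd : d = c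
    · rw [hd, h.1]
    · exact h.2 d hd

/-- The store that holds the values of the counters. -/
def counterStore (a : Fin 2 → ℕ) : ℕ → ℕ := fun d => if h : d < 2 then a ⟨d, h⟩ else 0

theorem counterStore_val (a : Fin 2 → ℕ) (c : Fin 2) : counterStore a c = a c := by
  simp only [counterStore, c.2, dite_true, Fin.eta]

theorem CounterMachine.Step.ruleStep {M : CounterMachine} {x y : CounterConfig} (h : M.Step x y) :
    RuleStep (M.2.map counterRule) (x.1, counterStore x.2) (y.1, counterStore y.2) := by
  obtain ⟨c, o, hm, he, hd⟩ := h
  refine ⟨o.toRegOp c, List.mem_map.2 ⟨_, hm, rfl⟩, ?_⟩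
  rw [CounterOp.toRegOp_iff]
  dsimp only
  rw [counterStore_val, counterStore_val]
  refine ⟨he, fun d hdc => ?_⟩
  simp only [counterStore]
  split_ifs with h
  · exact hd ⟨d, h⟩ fun e => hdc (congrArg Fin.val e)
  · rfl

theorem RuleStep.counterStep {M : CounterMachine} {x y : ℕ × (ℕ → ℕ)}
    (h : RuleStep (M.2.map counterRule) x y) :
    M.Step (x.1, fun c => x.2 c) (y.1, fun c => y.2 c) := by
  obtain ⟨o, ho, hg⟩ := h
  obtain ⟨⟨p, c, o', q⟩, hr, e⟩ := List.mem_map.1 ho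
  simp only [counterRule, Prod.mk.injEq] at e
  obtain ⟨rfl, rfl, rfl⟩ := e
  rw [CounterOp.toRegOp_iff] at hg
  exact ⟨c, o', hr, hg.1, fun d hd => hg.2 d fun e => hd (Fin.ext e)⟩

/-- Runs are transported by padding the counters with zero registers, and back by forgetting all
registers but the first two. -/
theorem CounterMachine.reaches_iff (M : CounterMachine) (q : ℕ) : M.Reaches q ↔
    ∃ t, Relation.ReflTransGen (RuleStep (M.2.map counterRule)) (M.1, inputStore 0) (q, t) := by
  constructor
  · rintro ⟨t, rfl, h⟩
    refine ⟨counterStore t.2, ?_⟩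
    have e : inputStore 0 = counterStore fun _ => 0 := by
      funext d
      simp [inputStore, counterStore]
    rw [e]
    exact h.lift (fun x : CounterConfig => (x.1, counterStore x.2)) fun _ _ => Step.ruleStep
  · rintro ⟨t, h⟩
    refine ⟨(q, fun c => t c), rfl, ?_⟩
    have := h.lift (fun x : ℕ × (ℕ → ℕ) => ((x.1, fun c => x.2 c) : CounterConfig))
      fun _ _ => RuleStep.counterStep
    simpa [inputStore, Function.onFun] using this

theorem bound_counterRule (r : CounterTransition) : (counterRule r).2.1.bound ≤ 2 := by
  obtain ⟨p, c, o, q⟩ := r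
  have := c.2
  cases o <;> simp only [counterRule, CounterOp.toRegOp, RegOp.bound] <;> omega

end Counters

/-! ### Runs versus satisfiability, validity and monitoring states -/

/-- The property that a run begins that leads from control state `p` and store `s` to control
state `q`. -/
def runProp (v : Fin n) (k : ℕ) (T : List (ℕ × RegOp × ℕ)) (p : ℕ) (s : ℕ → ℕ) (q : ℕ) :
    Property n :=
  .and (initProp v k p s) (reachProp v k T q)

theorem satisfiable_runProp_iff (v : Fin n) {k : ℕ} {T : List (ℕ × RegOp × ℕ)}
    (hT : ∀ r ∈ T, r.2.1.bound ≤ k) (p : ℕ) (s : ℕ → ℕ) (q : ℕ) :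
    Satisfiable (runProp v k T p s q) ↔
      ∃ t, Relation.ReflTransGen (RuleStep T) (p, s) (q, t) := by
  constructor
  · rintro ⟨τ, hτ, h1, h2⟩
    exact exists_run_of_holdsAt hT ((holdsAt_initProp (List.length_pos_iff.2 hτ)).1 h1) h2
  · rintro ⟨t, h⟩
    obtain ⟨L', hL'⟩ := exists_trace_of_run v hT h
    have hb := isBlock_blockTrace v k p s [] L'
    refine ⟨blockTrace n k p s ++ L', by simp [blockTrace], ?_, hL' []⟩
    exact (holdsAt_initProp hb.lt_length).2 hb

theorem valid_not_iff (ψ : Property n) : Valid (.not ψ) ↔ ¬ Satisfiable ψ := by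
  simp [Valid, Satisfiable, Satisfies, HoldsAt]

/-- The property that no run begins is permanently satisfied after a block if and only if there
is no run from the configuration that the block describes. -/
theorem InState.not_reachProp_iff (v : Fin n) {k : ℕ} {T : List (ℕ × RegOp × ℕ)}
    (hT : ∀ r ∈ T, r.2.1.bound ≤ k) {p : ℕ} {s : ℕ → ℕ} {q : ℕ} {m : MonitoringState}
    (h : InState (blockTrace n k p s) (.not (reachProp v k T q)) m) :
    m ≠ .ps ↔ ∃ t, Relation.ReflTransGen (RuleStep T) (p, s) (q, t) := by
  have sound : ∀ τ' : Trace n, ¬ Satisfies (blockTrace n k p s ++ τ') (.not (reachProp v k T q)) →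
      ∃ t, Relation.ReflTransGen (RuleStep T) (p, s) (q, t) := fun τ' h' =>
    exists_run_of_holdsAt hT (isBlock_blockTrace v k p s [] τ') (not_not.1 h')
  have sound' := sound []
  rw [List.append_nil] at sound'
  cases m with
  | cs =>
    obtain ⟨-, τ', -, h'⟩ := h
    exact iff_of_true (by simp) (sound τ' h')
  | ps =>
    refine iff_of_false (by simp) ?_
    rintro ⟨t, ht⟩
    obtain ⟨L', hL'⟩ := exists_trace_of_run v hT ht
    -- Monitoring states quantify over nonempty extensions only. If the run needs no further block,
    -- the block alone already violates the property.
    by_cases hn : L' = []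
    · refine h.1 ?_
      have := hL' []
      rwa [hn, List.append_nil] at this
    · exact h.2 L' hn (hL' [])
  | cv => exact iff_of_true (by simp) (sound' h.1)
  | pv => exact iff_of_true (by simp) (sound' h.1)

/-! ### Computability of the reductions -/

section Words

theorem Property.word_conj (l : List (Property n)) : (conj l).word =
    (l.flatMap fun φ => .inr 0 :: φ.word) ++ (ltc (.inr 0) (.inr 0) 1 : Property n).word := by
  induction l with
  | nil => rfl
  | cons φ l ih =>
    rw [List.flatMap_cons, List.append_assoc, ← ih]
    rfl

/-- The second negation of `Property.or` stands in front of the remaining disjunction. Moved to the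
end of the segment of `φ`, it makes the word a plain concatenation, to which closure under `flatMap`
applies. -/
theorem Property.word_disj (l : List (Property n)) : (disj l).word =
    (l.flatMap fun φ => .inr 1 :: .inr 0 :: .inr 1 :: (φ.word ++ [.inr 1])) ++
      (ltc (.inr 0) (.inr 0) 0 : Property n).word := by
  induction l with
  | nil => rfl
  | cons φ l ih =>
    rw [List.flatMap_cons, List.append_assoc, ← ih]
    simp [disj, Property.or, word]

/-- Integers are encoded with nonnegative numbers at even places and negative ones at odd places. -/
theorem primrec_natCast : Primrec fun a : ℕ => (a : ℤ) :=
  Primrec.encode_iff.1 (Primrec.nat_double.of_eq fun _ => rfl)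

theorem primrec_negSucc : Primrec Int.negSucc :=
  Primrec.encode_iff.1 (Primrec.nat_double_succ.of_eq fun _ => rfl)

theorem primrec_word_eqc (x : Fin n × ℕ) :
    Primrec fun z : ℤ => (Property.eqc (.inl x) (.inr z) 0 : Property n).word := by
  have h1 : Primrec fun z : ℤ => (Sum.inl (Sum.inl x, Sum.inr z, 1) : Letter n) :=
    Primrec.sumInl.comp ((Primrec.const _).pair (Primrec.sumInr.pair (Primrec.const _)))
  have h2 : Primrec fun z : ℤ => (Sum.inl (Sum.inr z, Sum.inl x, 1) : Letter n) :=
    Primrec.sumInl.comp (Primrec.sumInr.pair (Primrec.const _))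
  exact Primrec.list_cons.comp (Primrec.const _) (Primrec.list_cons.comp (Primrec.const _)
    (Primrec.list_cons.comp h1 (Primrec.list_cons.comp (Primrec.const _)
      (Primrec.list_cons.comp h2 (Primrec.const [])))))

theorem primrec_inputStore : Primrec₂ inputStore :=
  Primrec.ite (Primrec.eq.comp Primrec.snd (Primrec.const 0)) Primrec.fst (Primrec.const 0)

/-- The list is fixed, so each `g · b` may be treated separately; no uniformity in `b` and no coding
of `β` is needed. -/
theorem primrec_flatMap_const {α β σ : Type*} [Primcodable α] [Primcodable σ] (l : List β)
    {g : α → β → List σ} (hg : ∀ b, Primrec fun a => g a b) :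
    Primrec fun a => l.flatMap (g a) := by
  induction l with
  | nil => exact Primrec.const []
  | cons b l ih => exact Primrec.list_append.comp (hg b) ih

theorem primrec_word_initProp (v : Fin n) (k : ℕ) :
    Primrec fun x : ℕ × ℕ => (initProp v k x.1 (inputStore x.2)).word := by
  simp only [initProp, Property.word, Property.word_conj, List.flatMap_map]
  refine Primrec.list_cons.comp (Primrec.const _) (Primrec.list_append.comp
    ((primrec_word_eqc _).comp (primrec_negSucc.comp Primrec.fst)) (Primrec.list_append.comp
      (primrec_flatMap_const _ fun d => Primrec.list_cons.comp (Primrec.const _) ?_)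
      (Primrec.const _)))
  exact (primrec_word_eqc _).comp (primrec_natCast.comp
    (primrec_inputStore.comp Primrec.snd (Primrec.const d)))

instance : Finite CounterOp := Finite.of_equiv _ CounterOp.equivFin.symm

theorem primrec_word_ruleProp (v : Fin n) :
    Primrec fun r : CounterTransition => (ruleProp v 2 (counterRule r)).word := by
  -- This part of the formula depends only on the counter and the operation, of which there are
  -- finitely many.
  have h : Primrec fun r : CounterTransition => (opProp v 2 (counterRule r).2.1).word :=
    (Primrec.dom_finite fun x : Fin 2 × CounterOp => (opProp v 2 (x.2.toRegOp x.1)).word).comp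
      ((Primrec.fst.comp Primrec.snd).pair (Primrec.fst.comp (Primrec.snd.comp Primrec.snd)))
  have hq : Primrec fun r : CounterTransition => Int.negSucc r.2.2.2 :=
    primrec_negSucc.comp (Primrec.snd.comp (Primrec.snd.comp Primrec.snd))
  exact Primrec.list_cons.comp (Primrec.const _) (Primrec.list_append.comp
    ((primrec_word_eqc _).comp (primrec_negSucc.comp Primrec.fst))
    (Primrec.list_cons.comp (Primrec.const _) (Primrec.list_append.comp
      ((primrec_word_eqc _).comp hq) h)))

theorem primrec_word_runProp (v : Fin n) : Primrec fun x : CounterMachine × ℕ =>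
    (runProp v 2 (x.1.2.map counterRule) x.1.1 (inputStore 0) x.2).word := by
  have h : Primrec fun x : (CounterMachine × ℕ) × CounterTransition =>
      (ruleProp v 2 (counterRule x.2)).word :=
    Primrec.comp (f := fun r : CounterTransition => (ruleProp v 2 (counterRule r)).word)
      (primrec_word_ruleProp v) Primrec.snd
  simp only [runProp, reachProp, Property.word, Property.or, Property.word_disj, List.map_map,
    List.flatMap_map, Function.comp_apply]
  refine Primrec.list_cons.comp (Primrec.const _) (Primrec.list_append.comp
    ((primrec_word_initProp v 2).comp ((Primrec.fst.comp Primrec.fst).pair (Primrec.const 0)))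
    (Primrec.list_cons.comp (Primrec.const _) (Primrec.list_append.comp
      (Primrec.list_cons.comp (Primrec.const _) (Primrec.list_cons.comp (Primrec.const _)
        (Primrec.list_append.comp (Primrec.const _) (Primrec.list_cons.comp (Primrec.const _)
          (Primrec.list_append.comp (Primrec.list_flatMap (Primrec.snd.comp Primrec.fst) ?_)
            (Primrec.const _))))))
      ((primrec_word_eqc _).comp (primrec_negSucc.comp Primrec.snd)))))
  exact Primrec.list_cons.comp (Primrec.const _) (Primrec.list_cons.comp (Primrec.const _)
    (Primrec.list_cons.comp (Primrec.const _) (Primrec.list_append.comp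
      h (Primrec.const _))))

theorem primrec_blockTrace (k p : ℕ) : Primrec fun a => blockTrace n k p (inputStore a) := by
  refine Primrec.list_cons.comp (Primrec.const _) ?_
  have h : ∀ a, (List.range k).map (fun d => ((fun _ => (inputStore a d : ℤ)) : Assignment n)) =
      (List.range k).flatMap fun d => [fun _ => (inputStore a d : ℤ)] := fun a => by
    rw [← List.map_eq_flatMap]
  simp only [h]
  refine primrec_flatMap_const _ fun d => Primrec.list_cons.comp ?_ (Primrec.const [])
  exact Primrec.fin_curry.2 (primrec_natCast.comp
    (primrec_inputStore.comp Primrec.fst (Primrec.const d)))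

end Words

/-! ### Undecidability of monitoring and validity -/

theorem ComputablePred.of_partrec {α : Type*} [Primcodable α] {p : α → Prop} {f : α →. Bool}
    (hf : Partrec f) (h : ∀ a, ∃ b ∈ f a, (b = true ↔ p a)) : ComputablePred p := by
  choose g hg hp using h
  refine ComputablePred.computable_iff.2 ⟨g, hf.of_eq fun a => Part.eq_some_iff.2 (hg a), ?_⟩
  exact funext fun a => propext (hp a).symm

instance : Finite MonitoringState := Finite.of_equiv _ MonitoringState.equivFin.symm

theorem exists_bound (T : List (ℕ × RegOp × ℕ)) : ∃ k, ∀ r ∈ T, r.2.1.bound ≤ k :=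
  ⟨(T.map fun r => r.2.1.bound).sum, fun _ hr => List.le_sum_of_mem (List.mem_map_of_mem hr)⟩

/-- Monitoring is unsolvable already for a single property. -/
theorem exists_not_monitoringSolvableFor (v : Fin n) :
    ∃ ψ : Property n, IsGCProperty ψ ∧ ¬ MonitoringSolvableFor ψ := by
  obtain ⟨T, p, q, h⟩ := exists_rules_not_computable
  obtain ⟨k, hk⟩ := exists_bound T
  refine ⟨.not (reachProp v k T q), hasPolarity_reachProp v k T q, ?_⟩
  rintro ⟨f, hf, hs⟩
  classical
  -- The property stays fixed; the input `a` enters only through the observed trace.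
  refine h (ComputablePred.of_partrec (f := fun a => (f (blockTrace n k p (inputStore a))).map
    fun m => decide (m ≠ .ps)) ?_ fun a => ?_)
  · exact Partrec.map (hf.comp (primrec_blockTrace k p).to_comp)
      ((Primrec.dom_finite fun m : MonitoringState => decide (m ≠ .ps)).to_comp.comp
        Computable.snd)
  · obtain ⟨m, hm, hi⟩ := hs (blockTrace n k p (inputStore a)) (by simp [blockTrace])
    exact ⟨_, (Part.mem_map_iff _).2 ⟨m, hm, rfl⟩,
      decide_eq_true_iff.trans (hi.not_reachProp_iff v hk)⟩

theorem MonitoringSolvable.for {K : Property n → Prop} (h : MonitoringSolvable K) {ψ : Property n}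
    (hψ : K ψ) : MonitoringSolvableFor ψ := by
  obtain ⟨f, hf, hs⟩ := h
  exact ⟨fun τ => f (ψ.word, τ), hf.comp ((Computable.const _).pair Computable.id), hs ψ hψ⟩

/-- Validity has no observed trace to carry the input, so the input is written into the property,
whose first block is pinned down by `initProp`. -/
theorem not_validityDecidable (v : Fin n) : ¬ ValidityDecidable (n := n) IsGCProperty := by
  rintro ⟨f, hf, hs⟩
  obtain ⟨T, p, q, h⟩ := exists_rules_not_computable
  obtain ⟨k, hk⟩ := exists_bound T
  let ψ : ℕ → Property n := fun a => .not (runProp v k T p (inputStore a) q)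
  have hψ : Primrec fun a => (ψ a).word :=
    Primrec.list_cons.comp (Primrec.const _) (Primrec.list_cons.comp (Primrec.const _)
      (Primrec.list_append.comp ((primrec_word_initProp v k).comp
        ((Primrec.const p).pair Primrec.id)) (Primrec.const _)))
  refine h (ComputablePred.of_partrec (f := fun a => (f (ψ a).word).map not) ?_ fun a => ?_)
  · exact Partrec.map (hf.comp hψ.to_comp) (Primrec.not.to_comp.comp Computable.snd)
  · obtain ⟨b, hb, hv⟩ := hs (ψ a) ⟨hasPolarity_initProp _ _ _ _, hasPolarity_reachProp _ _ _ _⟩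
    refine ⟨!b, (Part.mem_map_iff _).2 ⟨b, hb, rfl⟩, ?_⟩
    rw [← satisfiable_runProp_iff v hk, Bool.not_eq_true', ← Bool.not_eq_true, hv, valid_not_iff,
      not_not]

end GapOrder

theorem mainTheorem10 (n : ℕ) (hn : 0 < n) :
    ¬ GapOrder.MonitoringSolvable (n := n) GapOrder.IsGCProperty ∧
    (∃ ψ : GapOrder.Property n,
      GapOrder.IsGCProperty ψ ∧ ¬ GapOrder.MonitoringSolvableFor ψ) ∧
    ¬ GapOrder.ValidityDecidable (n := n) GapOrder.IsGCProperty ∧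
    (∃ g : GapOrder.CounterMachine × ℕ → List (GapOrder.Letter n), Computable g ∧
      ∀ (M : GapOrder.CounterMachine) (q : ℕ), ∃ ψ : GapOrder.Property n,
        g (M, q) = ψ.word ∧ GapOrder.IsNegGCProperty ψ ∧
          (GapOrder.CounterMachine.Reaches M q ↔ GapOrder.Satisfiable ψ)) := by
  have single := GapOrder.exists_not_monitoringSolvableFor (⟨0, hn⟩ : Fin n)
  -- The map `g` is read off from `primrec_word_runProp`: the word of `runProp` with two registers,
  -- both zero at the start.
  refine ⟨fun h => ?_, single, GapOrder.not_validityDecidable ⟨0, hn⟩, _,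
    (GapOrder.primrec_word_runProp ⟨0, hn⟩).to_comp, fun M q => ⟨_, rfl,
      ⟨GapOrder.hasPolarity_initProp _ _ _ _, GapOrder.hasPolarity_reachProp _ _ _ _⟩, ?_⟩⟩
  · obtain ⟨ψ, hψ, hn⟩ := single
    exact hn (h.for hψ)
  · rw [GapOrder.CounterMachine.reaches_iff, GapOrder.satisfiable_runProp_iff]
    intro r hr
    obtain ⟨r, -, rfl⟩ := List.mem_map.1 hr
    exact GapOrder.bound_counterRule r
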